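/- **Proposition 2.5 (stationary set).** Let $H$ be a separable real Hilbert space with inner product $(\cdot,\cdot)$ and norm $\|\cdot\|$, and let $A$ be a positive self-adjoint operator in $H$ with an orthonormal eigenbasis $\{e_k\}_{k\ge1}$, $Ae_k=\lambda_ke_k$, $0<\lambda_1\le\lambda_2\le\dots$, $\lambda_k\to\infty$. For $s\ge0$ let $F_s=D(A^s)=\{\sum c_ke_k:\sum c_k^2\lambda_k^{2s}<\infty\}$ with the norm $\|v\|_s=\|A^sv\|$, and let $F_{-s}$ be the dual of $F_s$ with respect to the pivot space $H=F_0$. Let $\beta>0$, $\nu>0$, $\omega\in[0,1)$ and $p\in H$. Let $\mu_1,\mu_2\in C^1(0,\infty)\cap L^1(0,\infty)\cap C[0,\infty)$ satisfy $\mu_i\ge0$ and $\mu_i'+\delta_i\mu_i\le0$ with constants $\delta_i>0$; if $\omega=0$, assume in addition $\mu_2\not\equiv0$. Let $M:[0,\infty)\to\mathbb R$ be $C^2$ on $(0,\infty)$ and locally Lipschitz on $[0,\infty)$ (for instance $M\in C^2[0,\infty)$), with $\int_0^zM(\xi)\,d\xi\ge-az-b$ for all $z\ge0$, where $a\in(0,\lambda_1)$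 and $b\in\mathbb R$. For a Hilbert space $F$, let $L^2_{\mu_i}(\mathbb R_+;F)$ be the space with squared norm $\int_0^\infty\mu_i(s)\|\xi(s)\|_F^2\,ds$. On the Hilbert space $$\mathcal H=F_1\times F_0\times F_0\times L^2_{\mu_1}(\mathbb R_+;F_1)\times L^2_{\mu_2}(\mathbb R_+;F_{1/2})$$ define, for $U=(u;w;v;\bar\eta;\eta)$, $$\mathcal LU=\Bigl(w;\ -\beta A^2u-\int_0^\infty\mu_1(s)A^2\bar\eta(s)\,ds+\nu Av;\ -\omega Av-\int_0^\infty\mu_2(s)A\eta(s)\,ds-\nu Aw;\ -\bar\eta_s+w;\ -\eta_s+v\Bigr),$$ where $D(\mathcal L)$ consists of the $U\in\mathcal H$ such that $w\in F_1$, $v\in F_{1/2}$, the distributional derivatives satisfy $\bar\eta_s\in L^2_{\mu_1}(\mathbb R_+;F_1)$ and $\eta_s\in L^2_{\mu_2}(\mathbb R_+;F_{1/2})$, $\bar\eta(0)=0$, $\eta(0)=0$, $\beta A^2u+\int_0^\infty\mu_1A^2\bar\eta\,ds-\nu Av\in F_0$ (the sum being taken in $F_{-1}$) and $\omega Av+\int_0^\infty\mu_2A\eta\,ds\in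 F_0$ (the sum being taken in $F_{-1/2}$). Put $f(U)=(0;\,-M(\|A^{1/2}u\|^2)Au+p;\,0;\,0;\,0)$. A mild solution on $[0,T]$ of $\dot U=\mathcal LU+f(U)$, $U(0)=U_0$, is a function $U\in C([0,T];\mathcal H)$ with $U(t)=e^{t\mathcal L}U_0+\int_0^te^{(t-\tau)\mathcal L}f(U(\tau))\,d\tau$ for $t\in[0,T]$, where $e^{t\mathcal L}$ is the strongly continuous semigroup with infinitesimal generator $\mathcal L$. Let $S_tU_0=U(t)$, $t\ge0$, where $U$ is the mild solution starting from $U_0$ that is unique on every $[0,T]$. Then the set of stationary points $\mathcal N=\{U\in\mathcal H: S_tU=U\ \text{for all}\ t\ge0\}$ is $$\mathcal N=\bigl\{(u;0;0;0;0)\ :\ u\in D(A^2),\ \beta A^2u+M(\|A^{1/2}u\|^2)Au=p\bigr\}.$$ -/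

import Mathlib

open Set Filter Topology MeasureTheory
open scoped NNReal

noncomputable section

namespace Plate

/-! ### The operator `A` and the scale `F_s = D(A^s)` -/

/-- A positive self-adjoint operator `A` in a real Hilbert space `H` which has an eigenbasis
`e 0, e 1, …` with eigenvalues `0 < ev 0 ≤ ev 1 ≤ … → ∞`.  Such an operator is determined by these
data: `A` is the operator `v ↦ ∑ ev k ⟨e k, v⟩ e k` with its maximal domain. -/
structure DiagOp (H : Type*) [NormedAddCommGroup H] [InnerProductSpace ℝ H] where
  /-- the orthonormal eigenbasis -/
  e : HilbertBasis ℕ ℝ H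
  /-- the eigenvalues -/
  ev : ℕ → ℝ
  ev_pos : ∀ k, 0 < ev k
  ev_mono : Monotone ev
  ev_tendsto : Tendsto ev atTop atTop

section Scale

variable {H : Type*} [NormedAddCommGroup H] [InnerProductSpace ℝ H]

namespace DiagOp

variable (A : DiagOp H)

theorem summable_iff_memlp (s : ℝ) (v : H) :
    Summable (fun k => A.e.repr v k ^ 2 * A.ev k ^ (2 * s)) ↔
      Memℓp (fun k => A.ev k ^ s * A.e.repr v k) 2 := by
  rw [memℓp_gen_iff (by norm_num)]
  refine summable_congr fun k => ?_
  have h := (A.ev_pos k).le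
  simp only [ENNReal.toReal_ofNat, Real.rpow_ofNat, Real.norm_eq_abs, sq_abs, mul_pow]
  rw [mul_comm 2 s, Real.rpow_mul h, Real.rpow_ofNat, mul_comm]

/-- The domain `D(A^s) = {v = ∑ c_k e_k : ∑ c_k² λ_k^{2s} < ∞}` of the power `A^s`, `s ≥ 0`. -/
def dom (s : ℝ≥0) : Submodule ℝ H where
  carrier := {v | Summable fun k => A.e.repr v k ^ 2 * A.ev k ^ (2 * (s : ℝ))}
  zero_mem' := by simp [summable_zero]
  add_mem' := by
    intro v w hv hw
    simp only [mem_ofPred_eq, summable_iff_memlp] at hv hw ⊢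
    convert hv.add hw using 1
    ext k
    simp [mul_add]
  smul_mem' := by
    intro c v hv
    simp only [mem_ofPred_eq, summable_iff_memlp] at hv ⊢
    convert hv.const_smul c using 1
    ext k
    simp [mul_left_comm]

theorem memlp_of_mem {s : ℝ≥0} {v : H} (hv : v ∈ A.dom s) :
    Memℓp (fun k => A.ev k ^ (s : ℝ) * A.e.repr v k) 2 :=
  (A.summable_iff_memlp s v).1 hv

/-- The space `F_s = D(A^s)`: the elements of `D(A^s)`, with the norm `‖v‖_s = ‖A^s v‖` and the
inner product `(v, w)_s = (A^s v, A^s w)`, see the instances below. -/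
def Space (s : ℝ≥0) : Type _ := A.dom s

instance (s : ℝ≥0) : AddCommGroup (A.Space s) := inferInstanceAs (AddCommGroup (A.dom s))

instance (s : ℝ≥0) : Module ℝ (A.Space s) := inferInstanceAs (Module ℝ (A.dom s))

/-- `A^s` as a linear map from `F_s` to `H`: `A^s ∑ c_k e_k = ∑ λ_k^s c_k e_k`. -/
def powₗ (s : ℝ≥0) : A.Space s →ₗ[ℝ] H where
  toFun v := A.e.repr.symm ⟨fun k => A.ev k ^ (s : ℝ) * A.e.repr v.1 k, A.memlp_of_mem v.2⟩
  map_add' v w := by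
    rw [← map_add]
    congr 1
    ext k
    have h : (v + w).1 = v.1 + w.1 := rfl
    simp only [h, map_add, lp.coeFn_add, Pi.add_apply, mul_add]
  map_smul' c v := by
    rw [RingHom.id_apply, ← map_smul]
    congr 1
    ext k
    have h : (c • v).1 = c • v.1 := rfl
    simp [h, mul_left_comm]

theorem repr_powₗ (s : ℝ≥0) (v : A.Space s) (k : ℕ) :
    A.e.repr (A.powₗ s v) k = A.ev k ^ (s : ℝ) * A.e.repr v.1 k := by
  simp [powₗ]

theorem powₗ_injective (s : ℝ≥0) : Function.Injective (A.powₗ s) := by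
  intro v w h
  apply Subtype.ext
  apply A.e.repr.injective
  ext k
  have h1 := A.repr_powₗ s v k
  rw [h, A.repr_powₗ s w k] at h1
  exact (mul_left_cancel₀ (Real.rpow_pos_of_pos (A.ev_pos k) _).ne' h1).symm

instance (s : ℝ≥0) : NormedAddCommGroup (A.Space s) :=
  NormedAddCommGroup.induced _ _ (A.powₗ s) (A.powₗ_injective s)

instance (s : ℝ≥0) : InnerProductSpace ℝ (A.Space s) where
  norm_smul_le c v := by
    change ‖A.powₗ s (c • v)‖ ≤ ‖c‖ * ‖A.powₗ s v‖
    rw [map_smul, norm_smul]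
  inner v w := inner ℝ (A.powₗ s v) (A.powₗ s w)
  norm_sq_eq_re_inner v := by
    change ‖A.powₗ s v‖ ^ 2 = _
    simp
  conj_inner_symm v w := inner_conj_symm (𝕜 := ℝ) (A.powₗ s v) (A.powₗ s w)
  add_left u v w := by
    change inner ℝ (A.powₗ s (u + v)) _ = _
    rw [map_add, inner_add_left]
  smul_left v w c := by
    change inner ℝ (A.powₗ s (c • v)) _ = _
    rw [map_smul, inner_smul_left]

/-- `A^s` as a linear isometry from `F_s` to `H`. -/
def pow (s : ℝ≥0) : A.Space s →ₗᵢ[ℝ] H where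
  toLinearMap := A.powₗ s
  norm_map' _ := rfl

theorem pow_surjective (s : ℝ≥0) : Function.Surjective (A.pow s) := by
  intro g
  have hb : ∀ k, A.ev k ^ (-(s : ℝ)) ≤ A.ev 0 ^ (-(s : ℝ)) := fun k =>
    Real.rpow_le_rpow_of_nonpos (A.ev_pos 0) (A.ev_mono (Nat.zero_le k)) (by simp)
  have hm : Memℓp (fun k => A.ev k ^ (-(s : ℝ)) * A.e.repr g k) 2 := by
    refine ((lp.memℓp (A.e.repr g)).norm.const_smul (A.ev 0 ^ (-(s : ℝ)))).mono fun k => ?_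
    rw [norm_mul, Real.norm_of_nonneg (Real.rpow_pos_of_pos (A.ev_pos k) _).le]
    exact mul_le_mul_of_nonneg_right (hb k) (norm_nonneg _)
  have hk : ∀ k, A.ev k ^ (s : ℝ) * (A.ev k ^ (-(s : ℝ)) * A.e.repr g k) = A.e.repr g k := by
    intro k
    rw [← mul_assoc, ← Real.rpow_add (A.ev_pos k)]
    simp
  refine ⟨⟨A.e.repr.symm ⟨_, hm⟩, ?_⟩, ?_⟩
  · refine (A.summable_iff_memlp s _).2 ?_
    simp only [LinearIsometryEquiv.apply_symm_apply, hk]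
    exact lp.memℓp (A.e.repr g)
  · apply A.e.repr.injective
    ext k
    refine (A.repr_powₗ s _ k).trans ?_
    simp only [LinearIsometryEquiv.apply_symm_apply, hk]

instance (s : ℝ≥0) [CompleteSpace H] : CompleteSpace (A.Space s) := by
  rw [completeSpace_iff_isComplete_range (A.pow s).isometry.isUniformInducing,
    (A.pow_surjective s).range_eq]
  exact isClosed_univ.isComplete


theorem norm_coe_le (s : ℝ≥0) (v : A.Space s) :
    ‖(v.1 : H)‖ ≤ A.ev 0 ^ (-(s : ℝ)) * ‖v‖ := by
  have hc : 0 < A.ev 0 ^ (-(s : ℝ)) := Real.rpow_pos_of_pos (A.ev_pos 0) _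
  have h1 := lp.hasSum_norm (by norm_num) (A.e.repr v.1)
  have h2 := lp.hasSum_norm (by norm_num) (A.e.repr (A.powₗ s v))
  rw [LinearIsometryEquiv.norm_map] at h1 h2
  simp only [ENNReal.toReal_ofNat, Real.rpow_ofNat] at h1 h2
  have h3 : ‖(v.1 : H)‖ ^ 2 ≤ (A.ev 0 ^ (-(s : ℝ))) ^ 2 * ‖A.powₗ s v‖ ^ 2 := by
    refine hasSum_le (fun k => ?_) h1 (h2.mul_left _)
    rw [← mul_pow]
    refine pow_le_pow_left₀ (norm_nonneg _) ?_ 2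
    rw [A.repr_powₗ, norm_mul, ← mul_assoc,
      Real.norm_of_nonneg (Real.rpow_pos_of_pos (A.ev_pos k) _).le]
    refine le_mul_of_one_le_left (norm_nonneg _) ?_
    rw [Real.rpow_neg (A.ev_pos 0).le, inv_mul_eq_div,
      one_le_div (Real.rpow_pos_of_pos (A.ev_pos 0) _)]
    exact Real.rpow_le_rpow (A.ev_pos 0).le (A.ev_mono (Nat.zero_le k)) s.2
  rw [← mul_pow] at h3
  exact le_of_sq_le_sq h3 (by positivity)

/-- The continuous inclusion of `F_s` into `F_0 = H`. -/
def incl (s : ℝ≥0) : A.Space s →L[ℝ] H :=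
  LinearMap.mkContinuous
    { toFun := fun v => v.1, map_add' := fun _ _ => rfl, map_smul' := fun _ _ => rfl }
    (A.ev 0 ^ (-(s : ℝ))) (A.norm_coe_le s)

theorem dom_anti {s t : ℝ≥0} (h : s ≤ t) : A.dom t ≤ A.dom s := by
  intro v hv
  have hm := (A.memlp_of_mem hv).norm.const_smul (A.ev 0 ^ ((s : ℝ) - t))
  refine (A.summable_iff_memlp s v).2 (hm.mono fun k => ?_)
  have hst : (s : ℝ) - t ≤ 0 := sub_nonpos.2 (by exact_mod_cast h)
  have h1 : A.ev k ^ (s : ℝ) = A.ev k ^ ((s : ℝ) - t) * A.ev k ^ (t : ℝ) := by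
    rw [← Real.rpow_add (A.ev_pos k)]
    simp
  rw [h1, mul_assoc, norm_mul, Real.norm_of_nonneg (Real.rpow_pos_of_pos (A.ev_pos k) _).le]
  exact mul_le_mul_of_nonneg_right
    (Real.rpow_le_rpow_of_nonpos (A.ev_pos 0) (A.ev_mono (Nat.zero_le k)) hst) (norm_nonneg _)

/-- An element of `F_t`, regarded as an element of the larger space `F_s`, `s ≤ t`. -/
def lower {s t : ℝ≥0} (h : s ≤ t) (v : A.Space t) : A.Space s := ⟨v.1, A.dom_anti h v.2⟩

/-- `F_{-s}` is the dual of `F_s`, with `H` as pivot space. -/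
abbrev NegSpace (s : ℝ≥0) : Type _ := StrongDual ℝ (A.Space s)

/-- The embedding of `H = F_0` into `F_{-s}`: `g` is the functional `φ ↦ (g, φ)`. -/
def embNeg (s : ℝ≥0) (g : H) : A.NegSpace s := (innerSL ℝ g).comp (A.incl s)

/-- `A^s g ∈ F_{-s}` for `g ∈ H`, that is, the functional `φ ↦ (g, A^s φ)` on `F_s`. -/
def powNeg (s : ℝ≥0) (g : H) : A.NegSpace s :=
  (innerSL ℝ g).comp (A.pow s).toContinuousLinearMap

end DiagOp
end Scale

/-! ### The data of the model and its phase space -/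

/-- A memory kernel `κ` with decay rate `δ > 0`:
`κ ∈ C¹(0,∞) ∩ L¹(0,∞) ∩ C[0,∞)`, `κ ≥ 0` and `κ' + δ κ ≤ 0`. -/
structure IsMemoryKernel (κ : ℝ → ℝ) (δ : ℝ) : Prop where
  rate_pos : 0 < δ
  contDiffOn : ContDiffOn ℝ 1 κ (Ioi 0)
  integrableOn : IntegrableOn κ (Ioi 0)
  continuousOn : ContinuousOn κ (Ici 0)
  nonneg : ∀ s, 0 ≤ s → 0 ≤ κ s
  decay : ∀ s, 0 < s → deriv κ s + δ * κ s ≤ 0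

/-- The measure `κ(s) ds` on `(0,∞)`. -/
def kernelMeasure (κ : ℝ → ℝ) : Measure ℝ :=
  (volume.restrict (Ioi 0)).withDensity fun s => ENNReal.ofReal (κ s)

/-- The weighted space `L²_κ(0,∞; F)`, with squared norm `∫ κ(s) ‖ξ(s)‖² ds`. -/
abbrev MemorySpace (κ : ℝ → ℝ) (F : Type*) [NormedAddCommGroup F] : Type _ :=
  Lp F 2 (kernelMeasure κ)

/-- `η ∈ L²_κ(0,∞; F)` has the distributional derivative `η_s = ζ ∈ L²_κ(0,∞; F)` and `η(0) = 0`: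
`η` is represented by the locally absolutely continuous function `s ↦ ∫₀ˢ ζ(y) dy`.  (Under
`IsMemoryKernel` the kernel is positive exactly on an initial segment of `(0,∞)` and bounded below on
the intervals `(0,s)` inside it, so that `ζ` is integrable on `(0,s)`.) -/
def HasMemoryDeriv {F : Type*} [NormedAddCommGroup F] [NormedSpace ℝ F] {κ : ℝ → ℝ}
    (η ζ : MemorySpace κ F) : Prop :=
  ∀ᵐ s ∂kernelMeasure κ, η s = ∫ y in (0 : ℝ)..s, ζ y

/-- The operator `A`, parameters, nonlinearity, load and memory kernels of the plate model. -/
structure PlateData (H : Type*) [NormedAddCommGroup H] [InnerProductSpace ℝ H] where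
  A : DiagOp H
  β : ℝ
  ν : ℝ
  ω : ℝ
  M : ℝ → ℝ
  p : H
  μ₁ : ℝ → ℝ
  μ₂ : ℝ → ℝ

namespace PlateData

variable {H : Type*} [NormedAddCommGroup H] [InnerProductSpace ℝ H] (P : PlateData H)

/-- `F_1` -/
abbrev F1 : Type _ := P.A.Space 1

/-- `F_{1/2}` -/
abbrev Fhalf : Type _ := P.A.Space (1 / 2)

/-- The phase space `F_1 × H × H × L²_{μ₁}(0,∞; F_1) × L²_{μ₂}(0,∞; F_{1/2})`, a Hilbert space. -/
abbrev Phase : Type _ :=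
  WithLp 2 (P.F1 × WithLp 2 (H × WithLp 2 (H ×
    WithLp 2 (MemorySpace P.μ₁ P.F1 × MemorySpace P.μ₂ P.Fhalf))))

/-- The element `(u; w; v; η̄; η)` of the phase space. -/
def state (u : P.F1) (w v : H) (ηbar : MemorySpace P.μ₁ P.F1) (η : MemorySpace P.μ₂ P.Fhalf) :
    P.Phase :=
  WithLp.toLp 2 (u, WithLp.toLp 2 (w, WithLp.toLp 2 (v, WithLp.toLp 2 (ηbar, η))))

/-- The graph of the linear operator `L` of the model.
`(u; w; v; η̄; η) ∈ D(L)` and `L (u; w; v; η̄; η) = (u'; w'; v'; η̄'; η')` means that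
`w ∈ F_1`, `v ∈ F_{1/2}`, `η̄ ∈ D(T̄)`, `η ∈ D(T)` and
* `u' = w`,
* `w' = -β A²u - ∫ μ₁(s) A²η̄(s) ds + ν A v`, an equality in `F_{-1}` whose left side is in `H`,
* `v' + ν A w = -ω A v - ∫ μ₂(s) A η(s) ds`, an equality in `F_{-1/2}` whose left side is in `H`,
* `η̄' = -η̄_s + w` and `η' = -η_s + v`. -/
def IsLinearPart (U V : P.Phase) : Prop :=
  ∃ (u w : P.F1) (v : P.Fhalf) (ηbar ζbar ηbar' : MemorySpace P.μ₁ P.F1)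
    (η ζ η' : MemorySpace P.μ₂ P.Fhalf) (w' v' : H),
    U = P.state u w.1 v.1 ηbar η ∧ V = P.state w w' v' ηbar' η' ∧
    HasMemoryDeriv ηbar ζbar ∧ HasMemoryDeriv η ζ ∧
    P.A.embNeg 1 w' = -(P.β • P.A.powNeg 1 (P.A.pow 1 u))
      - (∫ s in Ioi (0 : ℝ), P.μ₁ s • P.A.powNeg 1 (P.A.pow 1 (ηbar s)))
      + P.ν • P.A.powNeg 1 v.1 ∧
    P.A.embNeg (1 / 2) (v' + P.ν • P.A.pow 1 w) =
      -(P.ω • P.A.powNeg (1 / 2) (P.A.pow (1 / 2) v))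
      - (∫ s in Ioi (0 : ℝ), P.μ₂ s • P.A.powNeg (1 / 2) (P.A.pow (1 / 2) (η s))) ∧
    (∀ᵐ s ∂kernelMeasure P.μ₁, ηbar' s = -ζbar s + w) ∧
    (∀ᵐ s ∂kernelMeasure P.μ₂, η' s = -ζ s + v)

/-- `M(‖A^{1/2}u‖²) A u` for `u ∈ F_1`. -/
def berger (u : P.F1) : H :=
  P.M (‖P.A.pow (1 / 2) (P.A.lower (half_le_self zero_le_one) u)‖ ^ 2) • P.A.pow 1 u

/-- The nonlinear term `f(U) = (0; -M(‖A^{1/2}u‖²) A u + p; 0; 0; 0)`. -/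
def nonlin (U : P.Phase) : P.Phase := P.state 0 (-P.berger U.fst + P.p) 0 0 0

end PlateData

/-! ### Semigroups and mild solutions -/

/-- `E t`, `t ≥ 0`, is a strongly continuous semigroup of bounded linear operators on `X`. (Values
at negative times play no role.) -/
structure IsC0Semigroup {X : Type*} [NormedAddCommGroup X] [NormedSpace ℝ X]
    (E : ℝ → X →L[ℝ] X) : Prop where
  zero : E 0 = ContinuousLinearMap.id ℝ X
  add : ∀ s t, 0 ≤ s → 0 ≤ t → E (s + t) = (E s).comp (E t)
  tendsto : ∀ x, Tendsto (fun t => E t x) (𝓝[>] 0) (𝓝 x)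

/-- `x` is in the domain of the infinitesimal generator of `E` and the generator maps `x` to `y`:
`(E t x - x) / t → y` as `t ↓ 0`. -/
def IsGenerated {X : Type*} [NormedAddCommGroup X] [NormedSpace ℝ X]
    (E : ℝ → X →L[ℝ] X) (x y : X) : Prop :=
  Tendsto (fun t : ℝ => t⁻¹ • (E t x - x)) (𝓝[>] 0) (𝓝 y)

namespace PlateData

variable {H : Type*} [NormedAddCommGroup H] [InnerProductSpace ℝ H] (P : PlateData H)

/-- `E` is the strongly continuous semigroup `e^{tL}`: its infinitesimal generator, domain
included, is `L`. -/
def IsLinearSemigroup (E : ℝ → P.Phase →L[ℝ] P.Phase) : Prop :=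
  IsC0Semigroup E ∧ ∀ U V, IsGenerated E U V ↔ P.IsLinearPart U V

/-- `U` is a mild solution on `[0,T]` of `U' = L U + f(U)`, `U(0) = U₀`: it is continuous on `[0,T]`
and `U(t) = e^{tL} U₀ + ∫₀ᵗ e^{(t-τ)L} f(U(τ)) dτ` there. -/
def IsMildSolution (T : ℝ) (U₀ : P.Phase) (U : ℝ → P.Phase) : Prop :=
  ContinuousOn U (Icc 0 T) ∧ ∃ E, P.IsLinearSemigroup E ∧
    ∀ t ∈ Icc 0 T, U t = E t U₀ + ∫ τ in (0 : ℝ)..t, E (t - τ) (P.nonlin (U τ))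

/-- `U` is the trajectory of `U₀`: on every interval `[0,T]` it is the unique mild solution. -/
def IsTrajectory (U₀ : P.Phase) (U : ℝ → P.Phase) : Prop :=
  ∀ T, 0 < T → P.IsMildSolution T U₀ U ∧
    ∀ V, P.IsMildSolution T U₀ V → EqOn V U (Icc 0 T)

/-- The semiflow `S_t U₀ = U(t)`, where `U` is the unique mild solution starting from `U₀`. It is a
partial function, so that no value is made up where unique solvability would fail. -/
def semiflow (t : ℝ) (U₀ : P.Phase) : Part P.Phase where
  Dom := ∃ U, P.IsTrajectory U₀ U
  get h := h.choose t

/-- The set of stationary points `{U₀ : S_t U₀ = U₀ for all t ≥ 0}`. -/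
def stationaryPoints : Set P.Phase :=
  {U₀ | ∀ t : ℝ, 0 ≤ t → P.semiflow t U₀ = Part.some U₀}

end PlateData
end Plate
end

namespace Plate

/-! ### Strongly continuous semigroups -/

section Semigroup

variable {X : Type*} [NormedAddCommGroup X] [NormedSpace ℝ X] {E : ℝ → X →L[ℝ] X}

/-! A constant function `U` satisfies the mild formula exactly when `L U = -f(U)`: the map `t ↦
e^{tL}U + ∫₀ᵗ e^{sL} f(U) ds` has right derivative `e^{tL}(LU + f(U))`, and conversely the
difference quotient of `e^{tL}U` at 0 is an average of `-e^{sL} f(U)`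
(`IsC0Semigroup.isGenerated_neg_iff`). So stationary points are the solutions of `L U + f(U) = 0`,
provided that a trajectory exists and is unique for these data.

Existence needs the semigroup itself. After the rescaling `u ↦ √β u` the operator `L` is
dissipative: the elastic, memory and thermal couplings cancel, leaving `-ω‖v‖²` and the memory
terms, which are nonpositive because the kernels decrease (`inner_rescale_nonpos`). The equation `U
- L U = Z` reduces to a coercive problem for `(w, v)`, solved by Lax–Milgram
(`exists_isLinearPart_sub`). The Yosida approximation then gives the semigroup
(`IsMaxDissipative.exists_semigroup`). Uniqueness is needed only for trajectories issuing from a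
stationary state; it follows from Gronwall's inequality and a Lipschitz bound for `f` centred at
that state (`eqOn_of_isMildSolution`).

It remains to solve `L U = -f(U)` (`isLinearPart_neg_nonlin_iff`). The first component gives `w =
0`, hence `η̄ = 0`; the last gives `η(s) = s v`. Testing the thermal equation with `v` yields `ω‖v‖²
+ ∫ s μ₂(s)‖v‖² ds = 0`, and since `ω > 0` or `μ₂ ≢ 0` this forces `v = 0` and `η = 0`. What is left
is the weak form of `βA²u = p - M(‖A^{1/2}u‖²)Au`; its right side lies in `H`, so `u ∈ D(A²)`. -/

theorem IsC0Semigroup.exists_bound_near_zero [CompleteSpace X] (hE : IsC0Semigroup E) :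
    ∃ δ > 0, ∃ C, ∀ t ∈ Icc 0 δ, ‖E t‖ ≤ C := by
  by_contra! h
  -- The maximum with `‖E 0‖` excludes `t n = 0`, so the points approach 0 from the right, where
  -- strong continuity is assumed; Banach–Steinhaus then contradicts the growth of `‖E (t n)‖`.
  choose t ht htn using fun n : ℕ => h (1 / ((n : ℝ) + 1)) (by positivity) (max n ‖E 0‖)
  have hpos : ∀ n, 0 < t n := by
    intro n
    rcases (ht n).1.eq_or_lt with h0 | h0
    · have := htn n
      rw [← h0] at this
      exact absurd this (not_lt.2 (le_max_right _ _))
    · exact h0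
  have hlim : Tendsto t atTop (𝓝[>] 0) := by
    refine tendsto_nhdsWithin_iff.2 ⟨?_, Eventually.of_forall hpos⟩
    exact squeeze_zero (fun n => (ht n).1) (fun n => (ht n).2) tendsto_one_div_add_atTop_nhds_zero_nat
  obtain ⟨C, hC⟩ := banach_steinhaus (g := fun n => E (t n)) fun x => by
    obtain ⟨C, hC⟩ := ((hE.tendsto x).comp hlim).norm.bddAbove_range
    exact ⟨C, fun n => hC ⟨n, rfl⟩⟩
  obtain ⟨n, hn⟩ := exists_nat_gt C
  exact absurd ((htn n).trans_le (hC n)) (not_lt.2 (hn.le.trans (le_max_left _ _)))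

theorem IsC0Semigroup.exists_bound [CompleteSpace X] (hE : IsC0Semigroup E) (T : ℝ) :
    ∃ C, 0 ≤ C ∧ ∀ t ∈ Icc 0 T, ‖E t‖ ≤ C := by
  obtain ⟨δ, hδ, C, hC⟩ := hE.exists_bound_near_zero
  have key : ∀ n : ℕ, ∃ K, 0 ≤ K ∧ ∀ t ∈ Icc 0 (n * δ), ‖E t‖ ≤ K := by
    intro n
    induction n with
    | zero =>
      refine ⟨‖E 0‖, norm_nonneg _, fun t ht => ?_⟩
      simp only [CharP.cast_eq_zero, zero_mul, Icc_self, mem_singleton_iff] at ht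
      rw [ht]
    | succ n ih =>
      obtain ⟨K, hK0, hK⟩ := ih
      have hC0 : 0 ≤ C := (norm_nonneg _).trans (hC 0 ⟨le_rfl, hδ.le⟩)
      refine ⟨K + K * C, by positivity, fun t ht => ?_⟩
      push_cast at ht
      rcases le_total t (n * δ) with h | h
      · exact (hK t ⟨ht.1, h⟩).trans (le_add_of_nonneg_right (by positivity))
      · have h1 := hE.add (n * δ) (t - n * δ) (by positivity) (by linarith)
        rw [add_sub_cancel] at h1
        rw [h1]
        refine (ContinuousLinearMap.opNorm_comp_le _ _).trans ?_
        have h2 := hK (n * δ) ⟨by positivity, le_rfl⟩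
        have h3 := hC (t - n * δ) ⟨by linarith, by linarith [ht.2]⟩
        have h4 := mul_le_mul h2 h3 (norm_nonneg _) hK0
        linarith
  obtain ⟨n, hn⟩ := exists_nat_gt (T / δ)
  obtain ⟨K, hK0, hK⟩ := key n
  refine ⟨K, hK0, fun t ht => hK t ⟨ht.1, ht.2.trans ?_⟩⟩
  rw [div_lt_iff₀ hδ] at hn
  exact hn.le

theorem IsC0Semigroup.tendsto_zero_Ici (hE : IsC0Semigroup E) (x : X) :
    Tendsto (fun t => E t x) (𝓝[≥] 0) (𝓝 x) := by
  have h : (Ici (0 : ℝ)) = insert 0 (Ioi 0) := Ioi_insert.symm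
  rw [h, nhdsWithin_insert, tendsto_sup]
  refine ⟨?_, hE.tendsto x⟩
  have h0 : E 0 x = x := by rw [hE.zero]; rfl
  rw [tendsto_pure_left]
  intro s hs
  rw [h0]
  exact mem_of_mem_nhds hs

/-- By the semigroup law the increment between `s` and `t` is `E (min s t)` applied to an increment
at 0. For `s < t` the factor `E s` varies with `s`, which is why a bound uniform on compact
intervals is needed. -/
theorem IsC0Semigroup.continuousOn [CompleteSpace X] (hE : IsC0Semigroup E) (x : X) :
    ContinuousOn (fun t => E t x) (Ici 0) := by
  intro t ht
  obtain ⟨C, hC0, hC⟩ := hE.exists_bound (t + 1)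
  have hb : ∀ s ∈ Icc 0 (t + 1), ‖E s x - E t x‖ ≤ C * ‖E |s - t| x - x‖ := by
    intro s hs
    rcases le_total s t with h | h
    · have h1 := hE.add s (t - s) hs.1 (by linarith)
      rw [add_sub_cancel] at h1
      rw [h1, ContinuousLinearMap.comp_apply, ← map_sub, abs_sub_comm, abs_of_nonneg (by linarith),
        norm_sub_rev (E _ x)]
      exact (E s).le_of_opNorm_le (hC s hs) _
    · have h1 := hE.add t (s - t) ht (by linarith)
      rw [add_sub_cancel] at h1
      rw [h1, ContinuousLinearMap.comp_apply, ← map_sub, abs_of_nonneg (by linarith)]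
      exact (E t).le_of_opNorm_le (hC t ⟨ht, by linarith⟩) _
  have hlim : Tendsto (fun s => C * ‖E |s - t| x - x‖) (𝓝[Ici 0] t) (𝓝 0) := by
    have h1 : Tendsto (fun s => |s - t|) (𝓝[Ici 0] t) (𝓝[≥] 0) := by
      refine tendsto_nhdsWithin_iff.2 ⟨?_, Eventually.of_forall fun s => mem_Ici.2 (abs_nonneg _)⟩
      have : Continuous fun s : ℝ => |s - t| := by fun_prop
      have h := this.tendsto t
      simp only [sub_self, abs_zero] at h
      exact h.mono_left nhdsWithin_le_nhds
    have h2 := (((hE.tendsto_zero_Ici x).comp h1).sub_const x).norm.const_mul C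
    simpa using h2
  refine tendsto_iff_norm_sub_tendsto_zero.2 (squeeze_zero' (Eventually.of_forall fun _ =>
    norm_nonneg _) ?_ hlim)
  filter_upwards [self_mem_nhdsWithin, mem_nhdsWithin_of_mem_nhds (Iio_mem_nhds (lt_add_one t))]
    with s hs1 hs2 using hb s ⟨hs1, hs2.le⟩


/-- Evaluation along a strongly continuous semigroup is jointly continuous. -/
theorem IsC0Semigroup.tendsto_apply [CompleteSpace X] (hE : IsC0Semigroup E) {ι : Type*}
    {l : Filter ι} {a : ι → ℝ} {h : ι → X} {t : ℝ} {x : X} (ht : 0 ≤ t)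
    (ha : Tendsto a l (𝓝[Ici 0] t)) (hh : Tendsto h l (𝓝 x)) :
    Tendsto (fun i => E (a i) (h i)) l (𝓝 (E t x)) := by
  obtain ⟨C, hC0, hC⟩ := hE.exists_bound (t + 1)
  have h1 : Tendsto (fun i => E (a i) x) l (𝓝 (E t x)) := (hE.continuousOn x t ht).tendsto.comp ha
  have h2 : Tendsto (fun i => E (a i) (h i - x)) l (𝓝 0) := by
    have h3 : Tendsto (fun i => C * ‖h i - x‖) l (𝓝 0) := by
      simpa using (hh.sub_const x).norm.const_mul C
    refine squeeze_zero_norm' ?_ h3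
    have ha' := tendsto_nhdsWithin_iff.1 ha
    filter_upwards [ha'.2, ha'.1.eventually (Iio_mem_nhds (lt_add_one t))] with i hi1 hi2
    exact (E (a i)).le_of_opNorm_le (hC _ ⟨hi1, hi2.le⟩) _
  simpa using h1.add h2

theorem IsC0Semigroup.continuousOn_apply [CompleteSpace X] (hE : IsC0Semigroup E) {S : Set ℝ}
    {a : ℝ → ℝ} {h : ℝ → X} (ha : ContinuousOn a S) (ha0 : ∀ s ∈ S, 0 ≤ a s)
    (hh : ContinuousOn h S) : ContinuousOn (fun s => E (a s) (h s)) S := fun s hs =>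
  hE.tendsto_apply (ha0 s hs) (tendsto_nhdsWithin_iff.2 ⟨ha s hs,
    eventually_nhdsWithin_of_forall ha0⟩) (hh s hs)

theorem IsC0Semigroup.commute (hE : IsC0Semigroup E) {s t : ℝ} (hs : 0 ≤ s) (ht : 0 ≤ t) (x : X) :
    E s (E t x) = E t (E s x) := by
  have h1 := hE.add s t hs ht
  rw [add_comm, hE.add t s ht hs] at h1
  exact (DFunLike.congr_fun h1 x).symm

theorem IsGenerated.apply (hE : IsC0Semigroup E) {x y : X} (h : IsGenerated E x y) {s : ℝ}
    (hs : 0 ≤ s) : IsGenerated E (E s x) (E s y) := by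
  have h1 := ((E s).continuous.tendsto y).comp h
  refine h1.congr' ?_
  filter_upwards [self_mem_nhdsWithin] with t ht
  simp only [Function.comp, map_smul, map_sub]
  rw [hE.commute hs (le_of_lt ht)]

/-- The one-sided limit defining the generator is carried from 0 to `s` by the semigroup law. A
right derivative is all that the constancy criterion for continuous functions requires. -/
theorem IsGenerated.hasDerivWithinAt (hE : IsC0Semigroup E) {x y : X} (h : IsGenerated E x y)
    {s : ℝ} (hs : 0 ≤ s) : HasDerivWithinAt (fun t => E t x) (E s y) (Ici s) s := by
  rw [← hasDerivWithinAt_Ioi_iff_Ici, hasDerivWithinAt_iff_tendsto_slope' self_notMem_Ioi]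
  have h1 : Tendsto (fun t => t - s) (𝓝[>] s) (𝓝[>] 0) := by
    refine tendsto_nhdsWithin_iff.2 ⟨?_, ?_⟩
    · have : Continuous fun t : ℝ => t - s := by fun_prop
      have h := this.tendsto s
      rw [sub_self] at h
      exact h.mono_left nhdsWithin_le_nhds
    · filter_upwards [self_mem_nhdsWithin] with t ht using mem_Ioi.2 (sub_pos.2 (mem_Ioi.1 ht))
  refine ((h.apply hE hs).comp h1).congr' ?_
  filter_upwards [self_mem_nhdsWithin] with t ht
  have ht' : s < t := ht
  have h2 := hE.add s (t - s) hs (by linarith)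
  rw [add_sub_cancel] at h2
  simp only [Function.comp, slope, vsub_eq_sub]
  rw [h2, hE.commute (by linarith) hs]
  rfl

theorem IsC0Semigroup.hasDerivWithinAt_integral [CompleteSpace X] (hE : IsC0Semigroup E) (g : X)
    {t : ℝ} (ht : 0 ≤ t) :
    HasDerivWithinAt (fun t => ∫ s in (0 : ℝ)..t, E s g) (E t g) (Ici t) t := by
  have hc := hE.continuousOn g
  refine intervalIntegral.integral_hasDerivWithinAt_right (t := Ioi t) ?_ ?_ ?_
  · exact (hc.mono fun s hs => by rw [uIcc_of_le ht] at hs; exact hs.1).intervalIntegrable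
  · exact ⟨Ioi t, self_mem_nhdsWithin, (hc.mono fun s hs =>
      ht.trans (le_of_lt hs)).aestronglyMeasurable measurableSet_Ioi⟩
  · exact (hc t ht).mono fun s hs => ht.trans (le_of_lt hs)

/-- `x` is a stationary mild solution of `U' = L U + g` if and only if `L x = -g`. -/
theorem IsC0Semigroup.isGenerated_neg_iff [CompleteSpace X] (hE : IsC0Semigroup E) (x g : X)
    {T : ℝ} (hT : 0 < T) : IsGenerated E x (-g) ↔
      ∀ t ∈ Icc 0 T, x = E t x + ∫ τ in (0 : ℝ)..t, E (t - τ) g := by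
  have hsub : ∀ t, ∫ τ in (0 : ℝ)..t, E (t - τ) g = ∫ s in (0 : ℝ)..t, E s g := fun t => by
    rw [intervalIntegral.integral_comp_sub_left (fun s => E s g), sub_self, sub_zero]
  simp only [hsub]
  constructor
  -- The right-hand side is continuous with right derivative `E s (-g) + E s g = 0`, hence equal to
  -- its value `x` at 0.
  · intro h t ht
    have hc : ContinuousOn (fun t => E t x + ∫ s in (0 : ℝ)..t, E s g) (Icc 0 T) := by
      refine ((hE.continuousOn x).mono fun s hs => hs.1).add ?_
      have := intervalIntegral.continuousOn_primitive_interval (μ := volume) (a := 0) (b := T)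
        (f := fun s => E s g) (((hE.continuousOn g).mono fun s hs => by
          rw [uIcc_of_le hT.le] at hs; exact hs.1).integrableOn_compact isCompact_uIcc)
      rwa [uIcc_of_le hT.le] at this
    have h0 := constant_of_has_deriv_right_zero hc (fun s hs => ?_) t ht
    · simpa [hE.zero] using h0.symm
    · have := (h.hasDerivWithinAt hE hs.1).fun_add (hE.hasDerivWithinAt_integral g hs.1)
      rwa [map_neg, neg_add_cancel] at this
  -- Conversely `(E t x - x) / t` is minus the mean of `E s g` over `(0, t)`, which tends to `-g`.
  · intro h
    have h1 := hE.hasDerivWithinAt_integral g le_rfl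
    rw [← hasDerivWithinAt_Ioi_iff_Ici, hasDerivWithinAt_iff_tendsto_slope' self_notMem_Ioi] at h1
    have h2 := h1.neg
    simp only [hE.zero, ContinuousLinearMap.coe_id', id] at h2
    refine h2.congr' ?_
    filter_upwards [Ioc_mem_nhdsGT hT] with t ht
    have h3 := h t ⟨ht.1.le, ht.2⟩
    have h4 : E t x - x = -∫ s in (0 : ℝ)..t, E s g := by
      nth_rewrite 2 [h3]
      abel
    simp [slope, h4]

end Semigroup
end Plate

namespace Plate

/-! ### Generation of contraction semigroups -/

section Generation

variable {X : Type*} [NormedAddCommGroup X] [InnerProductSpace ℝ X]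

/-- The graph of a dissipative linear operator `L` for which `1 - L` is onto. -/
structure IsMaxDissipative (G : Submodule ℝ (X × X)) : Prop where
  inner_nonpos : ∀ q ∈ G, inner ℝ q.2 q.1 ≤ 0
  range : ∀ z, ∃ q ∈ G, q.1 - q.2 = z
  eq_zero : ∀ y, ((0 : X), y) ∈ G → y = 0

variable {G : Submodule ℝ (X × X)}

/-- Cauchy–Schwarz for `l • q.1 - q.2` tested against `q.1`. -/
theorem mul_norm_le_of_dissipative (hG : ∀ q ∈ G, inner ℝ q.2 q.1 ≤ 0) {q : X × X}
    (hq : q ∈ G) {l : ℝ} : l * ‖q.1‖ ≤ ‖l • q.1 - q.2‖ := by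
  rcases eq_or_ne q.1 0 with h | h
  · simp [h]
  have h1 := real_inner_le_norm (l • q.1 - q.2) q.1
  rw [inner_sub_left, real_inner_smul_left, real_inner_self_eq_norm_sq] at h1
  have h2 := hG q hq
  have h3 : 0 < ‖q.1‖ := norm_pos_iff.2 h
  refine le_of_mul_le_mul_right ?_ h3
  nlinarith

/-- `J` is the resolvent at `l` of the operator with graph `G`. -/
structure IsResolvent (G : Submodule ℝ (X × X)) (l : ℝ) (J : X →L[ℝ] X) : Prop where
  mem : ∀ z, (J z, l • J z - z) ∈ G
  norm_le : ∀ z, l * ‖J z‖ ≤ ‖z‖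
  apply_sub : ∀ q ∈ G, J (l • q.1 - q.2) = q.1

/-- The dissipativity estimate applied to differences makes solutions unique, so any choice of
preimages is automatically linear and bounded by `l⁻¹`. -/
theorem exists_isResolvent (hG : ∀ q ∈ G, inner ℝ q.2 q.1 ≤ 0) {l : ℝ} (hl : 0 < l)
    (hr : ∀ z, ∃ q ∈ G, l • q.1 - q.2 = z) : ∃ J, IsResolvent G l J := by
  have huniq : ∀ q ∈ G, ∀ q' ∈ G, l • q.1 - q.2 = l • q'.1 - q'.2 → q.1 = q'.1 := by
    intro q hq q' hq' h
    have h1 := mul_norm_le_of_dissipative hG (G.sub_mem hq hq') (l := l)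
    have h2 : l • (q - q').1 - (q - q').2 = (l • q.1 - q.2) - (l • q'.1 - q'.2) := by
      simp only [Prod.fst_sub, Prod.snd_sub, smul_sub]
      abel
    rw [h2, h, sub_self, norm_zero] at h1
    have h3 : ‖(q - q').1‖ ≤ 0 := by
      by_contra! h3
      exact absurd h1 (not_le.2 (mul_pos hl h3))
    exact sub_eq_zero.1 (norm_le_zero_iff.1 h3)
  choose q hq hqz using hr
  have hmem : ∀ z, ((q z).1, l • (q z).1 - z) ∈ G := by
    intro z
    have : (q z).2 = l • (q z).1 - z := by
      nth_rewrite 3 [← hqz z]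
      abel
    rw [← this]
    exact hq z
  let J : X →ₗ[ℝ] X :=
    { toFun := fun z => (q z).1
      map_add' := fun z w => huniq _ (hq _) _ (G.add_mem (hq z) (hq w)) (by
        rw [hqz]
        nth_rewrite 1 [← hqz z, ← hqz w]
        simp only [Prod.fst_add, Prod.snd_add, smul_add]
        abel)
      map_smul' := fun c z => huniq _ (hq _) _ (G.smul_mem c (hq z)) (by
        rw [hqz]
        nth_rewrite 1 [← hqz z]
        simp only [Prod.smul_fst, Prod.smul_snd, smul_sub, smul_comm l c]) }
  have hn : ∀ z, l * ‖J z‖ ≤ ‖z‖ := fun z => by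
    have := mul_norm_le_of_dissipative hG (hq z) (l := l)
    rwa [hqz] at this
  refine ⟨J.mkContinuous l⁻¹ fun z => ?_, hmem, hn, fun p hp => ?_⟩
  · rw [inv_mul_eq_div, le_div_iff₀ hl, mul_comm]
    exact hn z
  · exact huniq _ (hq _) _ hp (hqz _)

/-- Resolvent identity: the graph element lying over `J z - K z` is recovered by `J` from `(m - l) •
K z` and by `K` from `(m - l) • J z`. For `m = l` the two resolvents coincide. -/
theorem IsResolvent.commute {l m : ℝ} {J K : X →L[ℝ] X} (hJ : IsResolvent G l J)
    (hK : IsResolvent G m K) : Commute J K := by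
  ext z
  change J (K z) = K (J z)
  have hsub := G.sub_mem (hJ.mem z) (hK.mem z)
  have h1 := hJ.apply_sub _ hsub
  have h2 := hK.apply_sub _ hsub
  simp only [Prod.mk_sub_mk] at h1 h2
  have e1 : l • (J z - K z) - (l • J z - z - (m • K z - z)) = (m - l) • K z := by module
  have e2 : m • (J z - K z) - (l • J z - z - (m • K z - z)) = (m - l) • J z := by module
  rw [e1, map_smul] at h1
  rw [e2, map_smul] at h2
  rcases eq_or_ne m l with rfl | hml
  · have h3 : ∀ w, J w = K w := fun w => by
      have := hK.apply_sub _ (hJ.mem w)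
      simp only [sub_sub_cancel] at this
      exact this.symm
    rw [h3, h3]
  · exact smul_right_injective _ (sub_ne_zero.2 hml) (h1.trans h2.symm)

theorem commute_exp_smul {L K : X →L[ℝ] X} (h : Commute L K) (t : ℝ) (x : X) :
    NormedSpace.exp (t • L) (K x) = K (NormedSpace.exp (t • L) x) :=
  DFunLike.congr_fun (((h.symm.smul_right t).exp_right).symm.eq) x

variable [CompleteSpace X]

/-- On `J w` the operator `(3/2) l - L` takes the value `(1 + (l/2) J) w`, and `‖(l/2) J‖ ≤ 1/2`, so
a Neumann series solves the equation. Iterating from `l = 1` reaches arbitrarily large `l`. -/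
theorem range_smul_sub_of_isResolvent {l : ℝ} {J : X →L[ℝ] X} (hl : 0 < l)
    (hJ : IsResolvent G l J) (z : X) : ∃ q ∈ G, ((3 / 2 : ℝ) * l) • q.1 - q.2 = z := by
  have hn : ‖-((l / 2) • J)‖ < 1 := by
    rw [norm_neg]
    refine lt_of_le_of_lt (ContinuousLinearMap.opNorm_le_bound _ (by norm_num : (0 : ℝ) ≤ 1 / 2)
      fun w => ?_) (by norm_num : (1 / 2 : ℝ) < 1)
    rw [smul_apply, norm_smul, Real.norm_of_nonneg (by positivity)]
    linarith [hJ.norm_le w]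
  obtain ⟨u, hu⟩ := isUnit_one_sub_of_norm_lt_one hn
  have h1 : (1 - -((l / 2) • J)) ((↑u⁻¹ : X →L[ℝ] X) z) = z := by
    rw [← hu]
    exact DFunLike.congr_fun (u.mul_inv) z
  refine ⟨_, hJ.mem ((↑u⁻¹ : X →L[ℝ] X) z), ?_⟩
  simp only [sub_apply, neg_apply, smul_apply, one_apply_eq_self] at h1
  refine Eq.trans ?_ h1
  module

namespace IsMaxDissipative

theorem exists_isResolvent_pow (hG : IsMaxDissipative G) (n : ℕ) :
    ∃ J, IsResolvent G ((3 / 2 : ℝ) ^ n) J := by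
  induction n with
  | zero =>
    refine exists_isResolvent hG.inner_nonpos (by simp) fun z => ?_
    simpa using hG.range z
  | succ n ih =>
    obtain ⟨J, hJ⟩ := ih
    refine exists_isResolvent hG.inner_nonpos (by positivity) ?_
    rw [pow_succ']
    exact range_smul_sub_of_isResolvent (by positivity) hJ

/-- Let `z` be orthogonal to the domain and write `z = x - Lx`. Then `0 = (z, x) = ‖x‖² - (Lx, x) ≥
‖x‖²`, so `x = 0`, and `eq_zero` gives `Lx = 0`. -/
theorem dense_domain (hG : IsMaxDissipative G) : Dense {x | ∃ y, (x, y) ∈ G} := by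
  have h1 : (G.map (LinearMap.fst ℝ X X))ᗮ = ⊥ := by
    rw [Submodule.eq_bot_iff]
    intro z hz
    obtain ⟨q, hq, rfl⟩ := hG.range z
    have h2 := (Submodule.mem_orthogonal _ _).1 hz q.1 ⟨q, hq, rfl⟩
    rw [inner_sub_right, real_inner_self_eq_norm_sq, real_inner_comm] at h2
    have h3 := hG.inner_nonpos q hq
    have h4 : q.1 = 0 := by
      have : ‖q.1‖ ^ 2 ≤ 0 := by linarith
      exact norm_eq_zero.1 (pow_eq_zero_iff two_ne_zero |>.1 (le_antisymm this (by positivity)))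
    have h5 : q.2 = 0 := hG.eq_zero _ (h4 ▸ hq)
    rw [h4, h5, sub_zero]
  have h2 := (Submodule.topologicalClosure_eq_top_iff (K := G.map (LinearMap.fst ℝ X X))).2 h1
  have h3 := Submodule.dense_iff_topologicalClosure_eq_top.2 h2
  convert h3 using 1
  ext x
  simp

/-- The Yosida approximation data: bounded operators `L n`, which commute, are dissipative and
converge to the given operator. -/
theorem exists_approx (hG : IsMaxDissipative G) : ∃ L : ℕ → X →L[ℝ] X,
    (∀ m n, Commute (L m) (L n)) ∧ (∀ n x, inner ℝ (L n x) x ≤ 0) ∧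
    (∀ q ∈ G, ∀ n, ‖L n q.1‖ ≤ ‖q.2‖) ∧
    ∀ q ∈ G, Tendsto (fun n => L n q.1) atTop (𝓝 q.2) := by
  choose J hJ using hG.exists_isResolvent_pow
  have hpos : ∀ n : ℕ, 0 < (3 / 2 : ℝ) ^ n := fun n => by positivity
  have hB : ∀ n z, ‖(3 / 2 : ℝ) ^ n • J n z‖ ≤ ‖z‖ := fun n z => by
    rw [norm_smul, Real.norm_of_nonneg (hpos n).le]
    exact (hJ n).norm_le z
  have hL : ∀ q ∈ G, ∀ n, (3 / 2 : ℝ) ^ n • J n q.1 - q.1 = J n q.2 := fun q hq n => by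
    rw [← map_smul]
    nth_rewrite 2 [← (hJ n).apply_sub q hq]
    rw [← map_sub, sub_sub_cancel]
  have hlim : Tendsto (fun n : ℕ => ((3 / 2 : ℝ) ^ n)⁻¹) atTop (𝓝 0) :=
    (tendsto_pow_atTop_atTop_of_one_lt (by norm_num)).inv_tendsto_atTop
  -- On the domain `l J x - x = J (L x)` has norm at most `l⁻¹ ‖L x‖`; density and `‖l J‖ ≤ 1`
  -- extend the limit to all of `X`.
  have hBlim : ∀ z, Tendsto (fun n => (3 / 2 : ℝ) ^ n • J n z) atTop (𝓝 z) := by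
    intro z
    rw [Metric.tendsto_atTop]
    intro ε hε
    obtain ⟨x, ⟨y, hxy⟩, hx⟩ := hG.dense_domain.exists_dist_lt z (by positivity : 0 < ε / 3)
    have h1 := hlim.mul_const ‖y‖
    rw [zero_mul] at h1
    obtain ⟨N, hN⟩ := (h1.eventually (gt_mem_nhds (by positivity : 0 < ε / 3))).exists_forall_of_atTop
    refine ⟨N, fun n hn => ?_⟩
    have e : (3 / 2 : ℝ) ^ n • J n z - z
        = (3 / 2 : ℝ) ^ n • J n (z - x) + ((3 / 2 : ℝ) ^ n • J n x - x) - (z - x) := by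
      rw [map_sub, smul_sub]
      abel
    rw [dist_eq_norm] at hx ⊢
    rw [e, hL _ hxy]
    refine (norm_sub_le _ _).trans_lt ?_
    have h2 := norm_add_le ((3 / 2 : ℝ) ^ n • J n (z - x)) (J n y)
    have h3 := hB n (z - x)
    have h4 := hN n hn
    have h5 : ‖J n y‖ ≤ ((3 / 2 : ℝ) ^ n)⁻¹ * ‖y‖ := by
      rw [inv_mul_eq_div, le_div_iff₀ (hpos n), mul_comm]
      exact (hJ n).norm_le y
    linarith
  have hLB : ∀ q ∈ G, ∀ n, ((3 / 2 : ℝ) ^ n • ((3 / 2 : ℝ) ^ n • J n - 1)) q.1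
      = (3 / 2 : ℝ) ^ n • J n q.2 := fun q hq n => by
    rw [← hL q hq n]
    simp
  -- The Yosida approximation `l (l J - 1)` with `l = (3/2)^n`; on the domain it equals `(l J) L`,
  -- and it is dissipative because `‖l J‖ ≤ 1`.
  refine ⟨fun n => (3 / 2 : ℝ) ^ n • ((3 / 2 : ℝ) ^ n • J n - 1), fun m n => ?_, fun n x => ?_,
    fun q hq n => ?_, fun q hq => ?_⟩
  · refine Commute.smul_left (Commute.smul_right ?_ _) _
    refine Commute.sub_left ?_ (Commute.one_left _)
    refine Commute.sub_right ?_ (Commute.one_right _)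
    exact (((hJ m).commute (hJ n)).smul_right _).smul_left _
  · simp only [smul_apply, sub_apply,
      one_apply_eq_self]
    rw [real_inner_smul_left, inner_sub_left, real_inner_self_eq_norm_sq]
    refine mul_nonpos_of_nonneg_of_nonpos (hpos n).le (sub_nonpos.2 ?_)
    refine (real_inner_le_norm _ _).trans ?_
    rw [sq]
    exact mul_le_mul_of_nonneg_right (hB n x) (norm_nonneg _)
  · rw [hLB q hq]
    exact hB n _
  · simp only [hLB q hq]
    exact hBlim _

end IsMaxDissipative

/-! #### Exponentials of bounded dissipative operators -/

theorem hasDerivAt_exp_smul_apply (L : X →L[ℝ] X) (x : X) (t : ℝ) :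
    HasDerivAt (fun s : ℝ => NormedSpace.exp (s • L) x) (NormedSpace.exp (t • L) (L x)) t := by
  have h := hasDerivAt_exp_smul_const (𝕂 := ℝ) L t
  simpa using h.clm_apply (hasDerivAt_const t x)

/-- The derivative of `‖e^{sL}x‖²` is `2 (L e^{sL}x, e^{sL}x) ≤ 0`. -/
theorem norm_exp_smul_apply_le {L : X →L[ℝ] X} (hL : ∀ x, inner ℝ (L x) x ≤ 0) {t : ℝ}
    (ht : 0 ≤ t) (x : X) : ‖NormedSpace.exp (t • L) x‖ ≤ ‖x‖ := by
  have hd : ∀ s : ℝ, HasDerivAt (fun s : ℝ => ‖NormedSpace.exp (s • L) x‖ ^ 2)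
      (2 * inner ℝ (NormedSpace.exp (s • L) x) (NormedSpace.exp (s • L) (L x))) s := fun s =>
    (hasDerivAt_exp_smul_apply L x s).norm_sq
  have h1 : Antitone fun s : ℝ => ‖NormedSpace.exp (s • L) x‖ ^ 2 := by
    refine antitone_of_deriv_nonpos (fun s => (hd s).differentiableAt) fun s => ?_
    rw [(hd s).deriv, commute_exp_smul (Commute.refl L), real_inner_comm]
    linarith [hL (NormedSpace.exp (s • L) x)]
  have h2 := h1 ht
  simp only [zero_smul, NormedSpace.exp_zero, one_apply_eq_self] at h2
  exact le_of_sq_le_sq h2 (norm_nonneg _)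

/-- The path `s ↦ e^{sL} e^{(t-s)K} x` joins the two vectors. By commutation its derivative is
`e^{sL} e^{(t-s)K} (Lx - Kx)`, and both exponentials are contractions. -/
theorem norm_exp_smul_sub_le {L K : X →L[ℝ] X} (hL : ∀ x, inner ℝ (L x) x ≤ 0)
    (hK : ∀ x, inner ℝ (K x) x ≤ 0) (h : Commute L K) {t : ℝ} (ht : 0 ≤ t) (x : X) :
    ‖NormedSpace.exp (t • L) x - NormedSpace.exp (t • K) x‖ ≤ ‖L x - K x‖ * t := by
  have hd : ∀ s : ℝ, HasDerivAt
      (fun s : ℝ => NormedSpace.exp (s • L) (NormedSpace.exp ((t - s) • K) x))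
      (NormedSpace.exp (s • L) (NormedSpace.exp ((t - s) • K) (L x - K x))) s := fun s => by
    have h1 := hasDerivAt_exp_smul_const (𝕂 := ℝ) L s
    have h2 := (hasDerivAt_exp_smul_apply K x (t - s)).scomp s ((hasDerivAt_id s).const_sub t)
    have h3 := h1.clm_apply h2
    refine h3.congr_deriv ?_
    change NormedSpace.exp (s • L) (L (NormedSpace.exp ((t - s) • K) x)) + _ = _
    rw [← commute_exp_smul h.symm (t - s) x, neg_smul, one_smul, map_neg, ← sub_eq_add_neg,
      ← map_sub, ← map_sub]
  have h1 := norm_image_sub_le_of_norm_deriv_le_segment' (a := 0) (b := t)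
    (fun s _ => (hd s).hasDerivWithinAt) (C := ‖L x - K x‖) (fun s hs =>
      (norm_exp_smul_apply_le hL hs.1 _).trans
        (norm_exp_smul_apply_le hK (sub_nonneg.2 hs.2.le) _)) t ⟨ht, le_rfl⟩
  simpa using h1

theorem norm_exp_smul_sub_self_le {L : X →L[ℝ] X} (hL : ∀ x, inner ℝ (L x) x ≤ 0) {t : ℝ}
    (ht : 0 ≤ t) (x : X) : ‖NormedSpace.exp (t • L) x - x‖ ≤ ‖L x‖ * t := by
  simpa using norm_exp_smul_sub_le hL (K := 0) (by simp) (Commute.zero_right L) ht x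

/-- Meant for Yosida approximations, where `y` is the limit of `L x` but need not lie in the domain
of the limit operator. The auxiliary `y'` is a nearby domain element, for which `‖L y'‖` stays
bounded along the approximation. -/
theorem norm_exp_smul_sub_sub_le {L : X →L[ℝ] X} (hL : ∀ x, inner ℝ (L x) x ≤ 0) {t : ℝ}
    (ht : 0 ≤ t) (x y y' : X) : ‖NormedSpace.exp (t • L) x - x - t • y‖ ≤
      (‖L x - y‖ + 2 * ‖y - y'‖ + ‖L y'‖ * t) * t := by
  have hd : ∀ s : ℝ, HasDerivAt (fun s : ℝ => NormedSpace.exp (s • L) x - x - s • y)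
      (NormedSpace.exp (s • L) (L x) - y) s := fun s => by
    simpa using ((hasDerivAt_exp_smul_apply L x s).sub_const x).fun_sub
      ((hasDerivAt_id s).smul_const y)
  have h1 := norm_image_sub_le_of_norm_deriv_le_segment' (a := 0) (b := t)
    (fun s _ => (hd s).hasDerivWithinAt) (C := ‖L x - y‖ + 2 * ‖y - y'‖ + ‖L y'‖ * t)
    (fun s hs => ?_) t ⟨ht, le_rfl⟩
  · simpa using h1
  · have e : NormedSpace.exp (s • L) (L x) - y = NormedSpace.exp (s • L) (L x - y)
        + (NormedSpace.exp (s • L) (y - y') + (NormedSpace.exp (s • L) y' - y') - (y - y')) := by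
      simp only [map_sub]
      abel
    rw [e]
    have h2 := norm_exp_smul_apply_le hL hs.1 (L x - y)
    have h3 := norm_exp_smul_apply_le hL hs.1 (y - y')
    have h4 := norm_exp_smul_sub_self_le hL hs.1 y'
    have h5 : ‖L y'‖ * s ≤ ‖L y'‖ * t := mul_le_mul_of_nonneg_left hs.2.le (norm_nonneg _)
    refine (norm_add_le _ _).trans ?_
    have h6 := norm_sub_le (NormedSpace.exp (s • L) (y - y') + (NormedSpace.exp (s • L) y' - y'))
      (y - y')
    have h7 := norm_add_le (NormedSpace.exp (s • L) (y - y')) (NormedSpace.exp (s • L) y' - y')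
    linarith

namespace IsMaxDissipative

/-- A densely defined maximal dissipative operator generates a contraction semigroup. -/
theorem exists_semigroup (hG : IsMaxDissipative G) :
    ∃ E : ℝ → X →L[ℝ] X, IsC0Semigroup E ∧ ∀ x y, IsGenerated E x y ↔ (x, y) ∈ G := by
  obtain ⟨L, hcomm, hdis, hbd, hlim⟩ := hG.exists_approx
  have hcontr : ∀ (t : ℝ), 0 ≤ t → ∀ n x, ‖NormedSpace.exp (t • L n) x‖ ≤ ‖x‖ :=
    fun t ht n x => norm_exp_smul_apply_le (hdis n) ht x
  have hcauchy : ∀ t : ℝ, 0 ≤ t → ∀ x, CauchySeq fun n => NormedSpace.exp (t • L n) x := by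
    intro t ht x
    rw [Metric.cauchySeq_iff]
    intro ε hε
    obtain ⟨x', ⟨y, hxy⟩, hx'⟩ := hG.dense_domain.exists_dist_lt x (by positivity : 0 < ε / 3)
    obtain ⟨N, hN⟩ := Metric.cauchySeq_iff.1 (hlim _ hxy).cauchySeq (ε / (3 * (t + 1)))
      (by positivity)
    refine ⟨N, fun m hm n hn => ?_⟩
    have h1 := hN m hm n hn
    rw [dist_eq_norm] at h1 hx' ⊢
    have e : NormedSpace.exp (t • L m) x - NormedSpace.exp (t • L n) x
        = NormedSpace.exp (t • L m) (x - x') - NormedSpace.exp (t • L n) (x - x')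
          + (NormedSpace.exp (t • L m) x' - NormedSpace.exp (t • L n) x') := by
      simp only [map_sub]
      abel
    rw [e]
    refine (norm_add_le _ _).trans_lt ?_
    have h2 := norm_sub_le (NormedSpace.exp (t • L m) (x - x')) (NormedSpace.exp (t • L n) (x - x'))
    have h3 := hcontr t ht m (x - x')
    have h4 := hcontr t ht n (x - x')
    have h5 := norm_exp_smul_sub_le (hdis m) (hdis n) (hcomm m n) ht x'
    have h6 : ‖L m x' - L n x'‖ * t ≤ ε / (3 * (t + 1)) * t :=
      mul_le_mul_of_nonneg_right h1.le ht
    have h7 : ε / (3 * (t + 1)) * t ≤ ε / 3 := by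
      rw [div_mul_eq_mul_div, div_le_div_iff₀ (by positivity) (by positivity)]
      nlinarith
    linarith
  -- The absolute value only serves to define the limit at negative times, where convergence is not
  -- available.
  choose F hF using fun (t : ℝ) (x : X) => cauchySeq_tendsto_of_complete (hcauchy |t| (abs_nonneg t) x)
  let E : ℝ → X →L[ℝ] X := fun t =>
    continuousLinearMapOfTendsto (fun n => NormedSpace.exp (|t| • L n)) (tendsto_pi_nhds.2 (hF t))
  have hE : ∀ t, 0 ≤ t → ∀ x, Tendsto (fun n => NormedSpace.exp (t • L n) x) atTop (𝓝 (E t x)) := by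
    intro t ht x
    have := hF t x
    rw [abs_of_nonneg ht] at this
    exact this
  have hEc : ∀ t, 0 ≤ t → ∀ x, ‖E t x‖ ≤ ‖x‖ := fun t ht x =>
    le_of_tendsto (hE t ht x).norm (Eventually.of_forall fun n => hcontr t ht n x)
  have hEs : IsC0Semigroup E := by
    refine ⟨?_, fun s t hs ht => ?_, fun x => ?_⟩
    · ext x
      refine tendsto_nhds_unique (hE 0 le_rfl x) ?_
      simp
    · ext x
      refine tendsto_nhds_unique (hE (s + t) (by positivity) x) ?_
      have h1 : ∀ n, NormedSpace.exp ((s + t) • L n) x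
          = NormedSpace.exp (s • L n) (NormedSpace.exp (t • L n) x) := fun n => by
        let _ : NormedAlgebra ℚ (X →L[ℝ] X) := NormedAlgebra.restrictScalars ℚ ℝ _
        rw [add_smul, NormedSpace.exp_add_of_commute
          (((Commute.refl (L n)).smul_left s).smul_right t)]
        rfl
      simp only [h1, ContinuousLinearMap.comp_apply]
      have h2 : Tendsto (fun n => NormedSpace.exp (s • L n) (NormedSpace.exp (t • L n) x - E t x))
          atTop (𝓝 0) := by
        refine squeeze_zero_norm (fun n => hcontr s hs n _) ?_
        simpa using ((hE t ht x).sub_const (E t x)).norm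
      simpa using h2.add (hE s hs (E t x))
    · rw [Metric.tendsto_nhdsWithin_nhds]
      intro ε hε
      obtain ⟨x', ⟨y, hxy⟩, hx'⟩ := hG.dense_domain.exists_dist_lt x (by positivity : 0 < ε / 3)
      refine ⟨ε / (3 * (‖y‖ + 1)), by positivity, fun t ht htd => ?_⟩
      have ht0 : 0 < t := ht
      rw [dist_eq_norm] at hx' htd ⊢
      rw [sub_zero, Real.norm_of_nonneg ht0.le] at htd
      have h1 : ‖E t x' - x'‖ ≤ ‖y‖ * t := by
        refine le_of_tendsto ((hE t ht0.le x').sub_const x').norm (Eventually.of_forall fun n => ?_)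
        exact (norm_exp_smul_sub_self_le (hdis n) ht0.le x').trans
          (mul_le_mul_of_nonneg_right (hbd _ hxy n) ht0.le)
      have h2 : ‖y‖ * t ≤ ε / 3 := by
        rw [lt_div_iff₀ (by positivity)] at htd
        nlinarith [norm_nonneg y]
      have e : E t x - x = E t (x - x') - (x - x') + (E t x' - x') := by
        rw [map_sub]
        abel
      rw [e]
      have h3 := norm_add_le (E t (x - x') - (x - x')) (E t x' - x')
      have h4 := norm_sub_le (E t (x - x')) (x - x')
      have h5 := hEc t ht0.le (x - x')
      linarith
  have hgen : ∀ x y, (x, y) ∈ G → IsGenerated E x y := by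
    intro x y hxy
    unfold IsGenerated
    rw [Metric.tendsto_nhdsWithin_nhds]
    intro ε hε
    obtain ⟨y', ⟨z, hyz⟩, hy'⟩ := hG.dense_domain.exists_dist_lt y (by positivity : 0 < ε / 4)
    refine ⟨ε / (2 * (‖z‖ + 1)), by positivity, fun t ht htd => ?_⟩
    have ht0 : 0 < t := ht
    rw [dist_eq_norm] at hy' htd ⊢
    rw [sub_zero, Real.norm_of_nonneg ht0.le] at htd
    have h1 : ‖E t x - x - t • y‖ ≤ (0 + 2 * ‖y - y'‖ + ‖z‖ * t) * t := by
      refine le_of_tendsto_of_tendsto (((hE t ht0.le x).sub_const x).sub_const (t • y)).norm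
        (g := fun n => (‖L n x - y‖ + 2 * ‖y - y'‖ + ‖z‖ * t) * t) ?_
        (Eventually.of_forall fun n => ?_)
      · have h2 := ((hlim _ hxy).sub_const y).norm
        simp only [sub_self, norm_zero] at h2
        exact ((h2.add_const _).add_const _).mul_const _
      · refine (norm_exp_smul_sub_sub_le (hdis n) ht0.le x y y').trans ?_
        have := mul_le_mul_of_nonneg_right (hbd _ hyz n) ht0.le
        exact mul_le_mul_of_nonneg_right (by linarith) ht0.le
    have e : t⁻¹ • (E t x - x) - y = t⁻¹ • (E t x - x - t • y) := by
      rw [smul_sub _ _ (t • y), inv_smul_smul₀ ht0.ne']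
    rw [e, norm_smul, norm_inv, Real.norm_of_nonneg ht0.le, inv_mul_eq_div, div_lt_iff₀ ht0]
    refine h1.trans_lt ((mul_lt_mul_iff_left₀ ht0).2 ?_)
    have h2 : ‖z‖ * t ≤ ε / 2 := by
      rw [lt_div_iff₀ (by positivity)] at htd
      nlinarith [norm_nonneg z]
    linarith
  refine ⟨E, hEs, fun x y => ⟨fun h => ?_, hgen x y⟩⟩
  -- Maximality: with `a - La = x - y`, the vector `x - a` is mapped to itself by the generator. For
  -- a contraction semigroup the generator is dissipative, so `x - a = 0`.
  obtain ⟨⟨a, b⟩, hab, hz⟩ := hG.range (x - y)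
  simp only at hz
  have h1 : IsGenerated E (x - a) (x - a) := by
    have h2 := Tendsto.sub h (hgen a b hab)
    have e : y - b = x - a := by
      rw [sub_eq_sub_iff_add_eq_add] at hz ⊢
      rw [add_comm, hz.symm, add_comm]
    rw [e] at h2
    refine h2.congr fun t => ?_
    rw [map_sub]
    module
  have h2 : inner ℝ (x - a) (x - a) ≤ 0 := by
    refine le_of_tendsto ((h1.inner (tendsto_const_nhds (x := x - a)))) ?_
    filter_upwards [self_mem_nhdsWithin] with t ht
    have ht0 : 0 < t := ht
    rw [real_inner_smul_left, inner_sub_left, real_inner_self_eq_norm_sq]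
    refine mul_nonpos_of_nonneg_of_nonpos (inv_nonneg.2 ht0.le) (sub_nonpos.2 ?_)
    refine (real_inner_le_norm _ _).trans ?_
    rw [sq]
    exact mul_le_mul_of_nonneg_right (hEc t ht0.le _) (norm_nonneg _)
  have h3 : x = a := by
    rw [real_inner_self_eq_norm_sq] at h2
    exact sub_eq_zero.1 (norm_eq_zero.1 (pow_eq_zero_iff two_ne_zero |>.1
      (le_antisymm h2 (by positivity))))
  subst h3
  rw [sub_right_inj] at hz
  rwa [← hz]

end IsMaxDissipative

/-- The generation theorem for an operator which is maximal dissipative after a change of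
coordinates. -/
theorem exists_semigroup_of_conj (T : X ≃L[ℝ] X)
    (hG : IsMaxDissipative (G.map (T.toLinearMap.prodMap T.toLinearMap))) :
    ∃ E : ℝ → X →L[ℝ] X, IsC0Semigroup E ∧ ∀ x y, IsGenerated E x y ↔ (x, y) ∈ G := by
  have hmem : ∀ x y, (T x, T y) ∈ G.map (T.toLinearMap.prodMap T.toLinearMap) ↔ (x, y) ∈ G := by
    intro x y
    constructor
    · rintro ⟨⟨a, b⟩, hab, h⟩
      obtain rfl : a = x := T.injective (Prod.mk.inj h).1
      obtain rfl : b = y := T.injective (Prod.mk.inj h).2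
      exact hab
    · exact fun h => ⟨_, h, rfl⟩
  obtain ⟨E, hE, hgen⟩ := hG.exists_semigroup
  refine ⟨fun t => (T.symm : X →L[ℝ] X) ∘L (E t) ∘L (T : X →L[ℝ] X), ⟨?_, ?_, ?_⟩, ?_⟩
  · ext x
    simp [hE.zero]
  · intro s t hs ht
    ext x
    simp [hE.add s t hs ht]
  · intro x
    have := (T.symm.continuous.tendsto _).comp (hE.tendsto (T x))
    simpa [Function.comp_def] using this
  · intro x y
    rw [← hmem, ← hgen]
    have h1 : ∀ t : ℝ, t⁻¹ • (E t (T x) - T x)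
        = T (t⁻¹ • (((T.symm : X →L[ℝ] X) ∘L (E t) ∘L (T : X →L[ℝ] X)) x - x)) := by
      intro t
      simp
    unfold IsGenerated
    simp only [h1]
    exact T.toHomeomorph.isInducing.tendsto_nhds_iff

end Generation
end Plate

namespace Plate

/-! ### Memory kernels -/

section Kernel

variable {κ : ℝ → ℝ} {δ : ℝ}

theorem IsMemoryKernel.antitoneOn (hκ : IsMemoryKernel κ δ) : AntitoneOn κ (Ici 0) := by
  refine antitoneOn_of_deriv_nonpos (convex_Ici 0) hκ.continuousOn ?_ ?_
  · rw [interior_Ici]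
    exact hκ.contDiffOn.differentiableOn one_ne_zero
  · rw [interior_Ici]
    intro s hs
    have hs0 : 0 < s := hs
    have h1 := hκ.decay s hs
    have h2 := mul_nonneg hκ.rate_pos.le (hκ.nonneg s hs0.le)
    linarith

theorem IsMemoryKernel.aemeasurable (hκ : IsMemoryKernel κ δ) :
    AEMeasurable κ (volume.restrict (Ioi 0)) :=
  (hκ.continuousOn.mono Ioi_subset_Ici_self).aemeasurable measurableSet_Ioi

theorem IsMemoryKernel.isFiniteMeasure (hκ : IsMemoryKernel κ δ) :
    IsFiniteMeasure (kernelMeasure κ) :=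
  isFiniteMeasure_withDensity_ofReal hκ.integrableOn.2

theorem IsMemoryKernel.ae_iff (hκ : IsMemoryKernel κ δ) {p : ℝ → Prop} :
    (∀ᵐ s ∂kernelMeasure κ, p s) ↔ ∀ᵐ s, 0 < s → 0 < κ s → p s := by
  unfold kernelMeasure
  rw [ae_withDensity_iff' hκ.aemeasurable.ennreal_ofReal, ae_restrict_iff' measurableSet_Ioi]
  simp only [ne_eq, ENNReal.ofReal_eq_zero, not_le]
  rfl

theorem IsMemoryKernel.ae_pos (hκ : IsMemoryKernel κ δ) :
    ∀ᵐ s ∂kernelMeasure κ, 0 < s ∧ 0 < κ s :=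
  hκ.ae_iff.2 (Eventually.of_forall fun _ h1 h2 => ⟨h1, h2⟩)

theorem IsMemoryKernel.pos_of_le (hκ : IsMemoryKernel κ δ) {s y : ℝ} (hs : 0 < κ s) (hy : 0 ≤ y)
    (hys : y ≤ s) : 0 < κ y :=
  hs.trans_le (hκ.antitoneOn hy (hy.trans hys) hys)

theorem IsMemoryKernel.ae_Ioc (hκ : IsMemoryKernel κ δ) {p : ℝ → Prop}
    (h : ∀ᵐ s ∂kernelMeasure κ, p s) {s : ℝ} (hs : 0 < κ s) :
    ∀ᵐ y ∂volume.restrict (Ioc 0 s), p y := by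
  rw [ae_restrict_iff' measurableSet_Ioc]
  filter_upwards [hκ.ae_iff.1 h] with y hy hys
  exact hy hys.1 (hκ.pos_of_le hs hys.1.le hys.2)

theorem IsMemoryKernel.lintegral_eq (hκ : IsMemoryKernel κ δ) (g : ℝ → ENNReal) :
    ∫⁻ s, g s ∂kernelMeasure κ = ∫⁻ s in Ioi 0, ENNReal.ofReal (κ s) * g s :=
  lintegral_withDensity_eq_lintegral_mul_non_measurable₀ _ hκ.aemeasurable.ennreal_ofReal
    (Eventually.of_forall fun _ => ENNReal.ofReal_lt_top) g

theorem IsMemoryKernel.integral_eq (hκ : IsMemoryKernel κ δ) {F : Type*} [NormedAddCommGroup F]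
    [NormedSpace ℝ F] (g : ℝ → F) : ∫ s, g s ∂kernelMeasure κ = ∫ s in Ioi 0, κ s • g s := by
  unfold kernelMeasure
  rw [integral_withDensity_eq_integral_toReal_smul₀ hκ.aemeasurable.ennreal_ofReal
    (Eventually.of_forall fun _ => ENNReal.ofReal_lt_top)]
  refine setIntegral_congr_fun measurableSet_Ioi fun s hs => ?_
  simp only [ENNReal.toReal_ofReal (hκ.nonneg s (le_of_lt hs))]

/-- As `κ` is nonincreasing, `κ ≥ κ s` on `(0, s]`. This makes weighted functions integrable near 0,
so that their primitives make sense. -/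
theorem IsMemoryKernel.restrict_le (hκ : IsMemoryKernel κ δ) {s : ℝ} (hs : 0 < κ s) :
    volume.restrict (Ioc 0 s) ≤ (ENNReal.ofReal (κ s))⁻¹ • kernelMeasure κ := by
  have h0 : ENNReal.ofReal (κ s) ≠ 0 := by simpa using hs
  have h1 : ENNReal.ofReal (κ s) • volume.restrict (Ioc 0 s) ≤ kernelMeasure κ := by
    rw [← withDensity_const]
    calc (volume.restrict (Ioc 0 s)).withDensity (fun _ => ENNReal.ofReal (κ s))
        ≤ (volume.restrict (Ioc 0 s)).withDensity (fun y => ENNReal.ofReal (κ y)) := by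
          refine withDensity_mono ?_
          filter_upwards [ae_restrict_mem measurableSet_Ioc] with y hy
          exact ENNReal.ofReal_le_ofReal (hκ.antitoneOn hy.1.le (hy.1.le.trans hy.2) hy.2)
      _ ≤ kernelMeasure κ := by
          have : volume.restrict (Ioc 0 s) = (volume.restrict (Ioi 0)).restrict (Ioc 0 s) := by
            rw [Measure.restrict_restrict measurableSet_Ioc,
              inter_eq_left.2 Ioc_subset_Ioi_self]
          rw [this, ← restrict_withDensity measurableSet_Ioc]
          exact Measure.restrict_le_self
  have h2 : (ENNReal.ofReal (κ s))⁻¹ • ENNReal.ofReal (κ s) • volume.restrict (Ioc 0 s)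
      ≤ (ENNReal.ofReal (κ s))⁻¹ • kernelMeasure κ := Measure.le_iff'.2 fun t => by
    rw [Measure.smul_apply _ (kernelMeasure κ), Measure.smul_apply]
    exact mul_le_mul_right (h1 t) _
  rwa [smul_smul, ENNReal.inv_mul_cancel h0 ENNReal.ofReal_ne_top, one_smul] at h2

theorem IsMemoryKernel.intervalIntegrable (hκ : IsMemoryKernel κ δ) {F : Type*}
    [NormedAddCommGroup F] {g : ℝ → F} (hg : Integrable g (kernelMeasure κ)) {s : ℝ} (hs0 : 0 ≤ s)
    (hs : 0 < κ s) : IntervalIntegrable g volume 0 s := by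
  rw [intervalIntegrable_iff_integrableOn_Ioc_of_le hs0]
  refine Integrable.mono_measure (hg.smul_measure ?_) (hκ.restrict_le hs)
  simpa using hs

theorem IsMemoryKernel.integrable (hκ : IsMemoryKernel κ δ) {F : Type*} [NormedAddCommGroup F]
    (η : MemorySpace κ F) : Integrable η (kernelMeasure κ) :=
  have := hκ.isFiniteMeasure
  (Lp.memLp η).integrable one_le_two

end Kernel

/-! ### Primitives -/

section Primitive

variable {F : Type*} [NormedAddCommGroup F] [NormedSpace ℝ F]

/-- Integration by parts against the primitive of an integrable function. -/
theorem integral_deriv_smul_primitive [CompleteSpace F] {φ φ' : ℝ → ℝ}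
    (hφ : ∀ x, HasDerivAt φ (φ' x) x)
    (hφ' : Continuous φ') {g : ℝ → F} {s : ℝ} (hs : 0 ≤ s) (hg : IntervalIntegrable g volume 0 s) :
    ∫ y in (0 : ℝ)..s, φ' y • ∫ x in (0 : ℝ)..y, g x =
      φ s • (∫ y in (0 : ℝ)..s, g y) - ∫ y in (0 : ℝ)..s, φ y • g y := by
  set μ := volume.restrict (Ioc 0 s) with hμ
  have hgμ : Integrable g μ := (intervalIntegrable_iff_integrableOn_Ioc_of_le hs).1 hg
  have hφμ : Integrable φ' μ :=
    (intervalIntegrable_iff_integrableOn_Ioc_of_le hs).1 (hφ'.intervalIntegrable 0 s)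
  have hmeas : MeasurableSet {q : ℝ × ℝ | q.2 ≤ q.1} := measurableSet_le measurable_snd measurable_fst
  have hint : Integrable ({q : ℝ × ℝ | q.2 ≤ q.1}.indicator fun q => φ' q.1 • g q.2) (μ.prod μ) :=
    (hφμ.smul_prod hgμ).indicator hmeas
  -- Fubini on the triangle `x ≤ y ≤ s`; since `g` is merely integrable, the inner `y`-integral of
  -- `φ'` is the one evaluated in closed form.
  have hswap := integral_integral_swap (μ := μ) (ν := μ)
    (f := fun y x => {q : ℝ × ℝ | q.2 ≤ q.1}.indicator (fun q => φ' q.1 • g q.2) (y, x)) hint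
  have h1 : ∀ y ∈ Ioc 0 s, ∫ x, {q : ℝ × ℝ | q.2 ≤ q.1}.indicator (fun q => φ' q.1 • g q.2) (y, x) ∂μ
      = φ' y • ∫ x in (0 : ℝ)..y, g x := by
    intro y hy
    rw [intervalIntegral.integral_of_le hy.1.le, ← integral_smul]
    have e : (fun x => {q : ℝ × ℝ | q.2 ≤ q.1}.indicator (fun q => φ' q.1 • g q.2) (y, x))
        = (Iic y).indicator fun x => φ' y • g x := rfl
    rw [e, integral_indicator measurableSet_Iic, hμ, Measure.restrict_restrict measurableSet_Iic,
      inter_comm, Ioc_inter_Iic, min_eq_right hy.2]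
  have h2 : ∀ x ∈ Ioc 0 s, ∫ y, {q : ℝ × ℝ | q.2 ≤ q.1}.indicator (fun q => φ' q.1 • g q.2) (y, x) ∂μ
      = φ s • g x - φ x • g x := by
    intro x hx
    have e : (fun y => {q : ℝ × ℝ | q.2 ≤ q.1}.indicator (fun q => φ' q.1 • g q.2) (y, x))
        = (Ici x).indicator fun y => φ' y • g x := rfl
    have e2 : Ici x ∩ Ioc 0 s = Icc x s := by
      ext y
      simp only [mem_inter_iff, mem_Ici, mem_Ioc, mem_Icc]
      exact ⟨fun h => ⟨h.1, h.2.2⟩, fun h => ⟨h.1, hx.1.trans_le h.1, h.2⟩⟩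
    rw [e, integral_indicator measurableSet_Ici, hμ, Measure.restrict_restrict measurableSet_Ici,
      e2, integral_Icc_eq_integral_Ioc, integral_smul_const, ← intervalIntegral.integral_of_le hx.2,
      intervalIntegral.integral_eq_sub_of_hasDerivAt (fun y _ => hφ y)
        (hφ'.intervalIntegrable _ _), sub_smul]
  have hc : Continuous φ := continuous_iff_continuousAt.2 fun x => (hφ x).continuousAt
  have hsub := intervalIntegral.integral_sub (f := fun y => φ s • g y) (hg.smul (φ s))
    (hg.continuousOn_smul hc.continuousOn)
  rw [← intervalIntegral.integral_smul, ← hsub, intervalIntegral.integral_of_le hs,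
    intervalIntegral.integral_of_le hs, ← setIntegral_congr_fun measurableSet_Ioc h1,
    ← setIntegral_congr_fun measurableSet_Ioc h2]
  exact hswap

/-- The solution of `η' + l η = g`, `η(0) = 0`. -/
noncomputable def decayConv (l : ℝ) (g : ℝ → F) (s : ℝ) : F :=
  ∫ y in (0 : ℝ)..s, Real.exp (-(l * (s - y))) • g y

theorem decayConv_eq (l : ℝ) (g : ℝ → F) (s : ℝ) :
    decayConv l g s = Real.exp (-(l * s)) • ∫ y in (0 : ℝ)..s, Real.exp (l * y) • g y := by
  unfold decayConv
  rw [← intervalIntegral.integral_smul]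
  refine intervalIntegral.integral_congr fun y _ => ?_
  simp only [smul_smul, ← Real.exp_add]
  ring_nf

/-- The integrated form of `η' = g - l η`, obtained by parts with `e^{-ly}` against the primitive of
`e^{ly} g`. -/
theorem decayConv_eq_integral [CompleteSpace F] (l : ℝ) {g : ℝ → F} {s : ℝ} (hs : 0 ≤ s)
    (hg : IntervalIntegrable g volume 0 s) :
    decayConv l g s = ∫ y in (0 : ℝ)..s, (g y - l • decayConv l g y) := by
  have hge : IntervalIntegrable (fun y => Real.exp (l * y) • g y) volume 0 s :=
    hg.continuousOn_smul (by fun_prop)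
  have h1 := integral_deriv_smul_primitive (φ := fun y => Real.exp (-(l * y)))
    (φ' := fun y => -l * Real.exp (-(l * y))) (fun x => by
      have := ((hasDerivAt_id x).const_mul l).neg.exp
      simpa [mul_comm] using this) (by fun_prop) hs hge
  rw [← decayConv_eq] at h1
  have h2 : ∀ y, Real.exp (-(l * y)) • Real.exp (l * y) • g y = g y := fun y => by
    rw [smul_smul, ← Real.exp_add, neg_add_cancel, Real.exp_zero, one_smul]
  have h3 : ∀ y, (-l * Real.exp (-(l * y))) • ∫ x in (0 : ℝ)..y, Real.exp (l * x) • g x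
      = -(l • decayConv l g y) := fun y => by
    rw [decayConv_eq, mul_smul, neg_smul]
  simp only [h2, h3] at h1
  have hci : IntervalIntegrable (fun y => l • decayConv l g y) volume 0 s := by
    simp only [decayConv_eq]
    refine IntervalIntegrable.smul ?_ l
    have := intervalIntegral.continuousOn_primitive_interval (μ := volume)
      (hge.def'.congr_set_ae (by rw [uIoc_of_le hs, uIcc_of_le hs]; exact Ioc_ae_eq_Icc.symm))
    exact (ContinuousOn.smul (by fun_prop) this).intervalIntegrable
  rw [intervalIntegral.integral_neg, eq_sub_iff_add_eq] at h1
  rw [intervalIntegral.integral_sub hg hci, ← h1]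
  abel

/-- The uniqueness counterpart: a primitive `η` of `ζ` solves `η' + l η = l η + ζ`, and the
integrating factor `e^{ly}` recovers it from that right side. -/
theorem primitive_eq_decayConv [CompleteSpace F] (l : ℝ) {ζ : ℝ → F} {s : ℝ} (hs : 0 ≤ s)
    (hζ : IntervalIntegrable ζ volume 0 s) :
    ∫ y in (0 : ℝ)..s, ζ y = decayConv l (fun y => l • (∫ x in (0 : ℝ)..y, ζ x) + ζ y) s := by
  have h1 := integral_deriv_smul_primitive (φ := fun y => Real.exp (l * y))
    (φ' := fun y => Real.exp (l * y) * l) (fun x => by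
      have := ((hasDerivAt_id x).const_mul l).exp
      simpa using this) (by fun_prop) hs hζ
  have hζe : IntervalIntegrable (fun y => Real.exp (l * y) • ζ y) volume 0 s :=
    hζ.continuousOn_smul (by fun_prop)
  have hci : IntervalIntegrable (fun y => (Real.exp (l * y) * l) • ∫ x in (0 : ℝ)..y, ζ x)
      volume 0 s := by
    have := intervalIntegral.continuousOn_primitive_interval (μ := volume)
      (hζ.def'.congr_set_ae (by rw [uIoc_of_le hs, uIcc_of_le hs]; exact Ioc_ae_eq_Icc.symm))
    exact (ContinuousOn.smul (by fun_prop) this).intervalIntegrable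
  rw [decayConv_eq]
  simp only [smul_add, smul_smul]
  rw [intervalIntegral.integral_add hci hζe, h1, sub_add_cancel, smul_smul, ← Real.exp_add,
    neg_add_cancel, Real.exp_zero, one_smul]

end Primitive

end Plate

namespace Plate

/-! ### The memory operator -/

theorem lintegral_exp_Iic {l : ℝ} (hl : 0 < l) (s : ℝ) :
    ∫⁻ y in Iic s, ENNReal.ofReal (Real.exp (-(l * (s - y)))) = ENNReal.ofReal l⁻¹ := by
  have e : ∀ y, Real.exp (-(l * (s - y))) = Real.exp (-(l * s)) * Real.exp (l * y) := fun y => by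
    rw [← Real.exp_add]
    ring_nf
  simp only [e]
  rw [← ofReal_integral_eq_lintegral_ofReal ((integrableOn_exp_mul_Iic hl s).const_mul _)
    (Eventually.of_forall fun y => by positivity), integral_const_mul, integral_exp_mul_Iic hl,
    ← mul_div_assoc, ← Real.exp_add, neg_add_cancel, Real.exp_zero, one_div]

theorem lintegral_exp_Ioi {l : ℝ} (hl : 0 < l) (y : ℝ) :
    ∫⁻ s in Ioi y, ENNReal.ofReal (Real.exp (-(l * (s - y)))) = ENNReal.ofReal l⁻¹ := by
  have e : ∀ s, Real.exp (-(l * (s - y))) = Real.exp (l * y) * Real.exp (-l * s) := fun s => by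
    rw [← Real.exp_add]
    ring_nf
  simp only [e]
  rw [← ofReal_integral_eq_lintegral_ofReal
    ((integrableOn_exp_mul_Ioi (neg_lt_zero.2 hl) y).const_mul _)
    (Eventually.of_forall fun y => by positivity), integral_const_mul,
    integral_exp_mul_Ioi (neg_lt_zero.2 hl), neg_div_neg_eq,
    ← mul_div_assoc, ← Real.exp_add, neg_mul, add_neg_cancel, Real.exp_zero, one_div]

theorem sq_lintegral_mul_le {α : Type*} [MeasurableSpace α] (μ : Measure α) {w f : α → ENNReal}
    (hw : AEMeasurable w μ) (hf : AEMeasurable f μ) :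
    (∫⁻ x, w x * f x ∂μ) ^ 2 ≤ (∫⁻ x, w x ∂μ) * ∫⁻ x, w x * f x ^ 2 ∂μ := by
  have h := ENNReal.lintegral_mul_le_Lp_mul_Lq μ Real.HolderConjugate.two_two
    (f := fun x => w x ^ (1 / 2 : ℝ)) (g := fun x => w x ^ (1 / 2 : ℝ) * f x)
    (hw.pow_const _) ((hw.pow_const _).mul hf)
  have hsq : ∀ a : ENNReal, (a ^ (1 / 2 : ℝ)) ^ (2 : ℝ) = a := fun a => by
    rw [← ENNReal.rpow_mul]
    norm_num
  have hmul : ∀ a : ENNReal, a ^ (1 / 2 : ℝ) * a ^ (1 / 2 : ℝ) = a := fun a => by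
    have := hsq a
    rwa [ENNReal.rpow_two, sq] at this
  simp only [Pi.mul_apply, ← mul_assoc, hmul, hsq, ENNReal.mul_rpow_of_nonneg _ _ zero_le_two,
    ENNReal.rpow_two] at h
  have h2 := pow_le_pow_left₀ zero_le h 2
  rw [mul_pow, ← ENNReal.rpow_two, ← ENNReal.rpow_two, ← ENNReal.rpow_two, hsq, hsq] at h2
  simpa only [ENNReal.rpow_two, sq, mul_assoc, hmul] using h2

section Memory

variable {κ : ℝ → ℝ} {δ : ℝ} {F : Type*} [NormedAddCommGroup F]

theorem enorm_decayConv_sq_le [NormedSpace ℝ F] {l : ℝ} (hl : 0 < l) {g : ℝ → F}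
    (hg : StronglyMeasurable g) {s : ℝ} (hs : 0 < s) :
    ‖decayConv l g s‖ₑ ^ 2 ≤ ENNReal.ofReal l⁻¹ *
      ∫⁻ y in Ioc 0 s, ENNReal.ofReal (Real.exp (-(l * (s - y)))) * ‖g y‖ₑ ^ 2 := by
  have h1 : ‖decayConv l g s‖ₑ ≤
      ∫⁻ y in Ioc 0 s, ENNReal.ofReal (Real.exp (-(l * (s - y)))) * ‖g y‖ₑ := by
    rw [decayConv, intervalIntegral.integral_of_le hs.le]
    refine (enorm_integral_le_lintegral_enorm _).trans_eq (lintegral_congr fun y => ?_)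
    rw [enorm_smul, Real.enorm_of_nonneg (Real.exp_pos _).le]
  refine (pow_le_pow_left₀ zero_le h1 2).trans ((sq_lintegral_mul_le _
    (Measurable.aemeasurable (by fun_prop)) hg.enorm.aemeasurable).trans ?_)
  refine mul_le_mul_left ?_ _
  rw [← lintegral_exp_Iic hl s]
  exact lintegral_mono_set Ioc_subset_Iic_self

/-- Schur test: the kernel `e^{-l(s-y)}` on `y ≤ s` has mass at most `l⁻¹` in either variable. The
weight passes from `s` to `y` because `κ s ≤ κ y` for `s ≥ y`. -/
theorem IsMemoryKernel.lintegral_decayConv_le [NormedSpace ℝ F] (hκ : IsMemoryKernel κ δ) {l : ℝ}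
    (hl : 0 < l) {g : ℝ → F} (hg : StronglyMeasurable g) :
    ∫⁻ s, ‖decayConv l g s‖ₑ ^ 2 ∂kernelMeasure κ ≤
      ENNReal.ofReal l⁻¹ ^ 2 * ∫⁻ s, ‖g s‖ₑ ^ 2 ∂kernelMeasure κ := by
  set w : ℝ → ℝ → ENNReal := fun s y => ENNReal.ofReal (Real.exp (-(l * (s - y)))) with hw
  have hwm : Measurable fun q : ℝ × ℝ => w q.1 q.2 := by fun_prop
  set ν := volume.restrict (Ioi (0 : ℝ)) with hν
  have hmeas : MeasurableSet {q : ℝ × ℝ | q.2 ≤ q.1} := measurableSet_le measurable_snd measurable_fst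
  have hκm : AEMeasurable (fun q : ℝ × ℝ => ENNReal.ofReal (κ q.1)) (ν.prod ν) :=
    hκ.aemeasurable.ennreal_ofReal.comp_fst
  have hgm : Measurable fun q : ℝ × ℝ => ‖g q.2‖ₑ ^ 2 :=
    (hg.enorm.comp measurable_snd).pow_const 2
  have hm : AEMeasurable ({q : ℝ × ℝ | q.2 ≤ q.1}.indicator
      fun q => ENNReal.ofReal (κ q.1) * (w q.1 q.2 * ‖g q.2‖ₑ ^ 2)) (ν.prod ν) :=
    (hκm.mul (hwm.mul hgm).aemeasurable).indicator hmeas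
  have hswap := lintegral_lintegral_swap (μ := ν) (ν := ν)
    (f := fun s y => {q : ℝ × ℝ | q.2 ≤ q.1}.indicator
      (fun q => ENNReal.ofReal (κ q.1) * (w q.1 q.2 * ‖g q.2‖ₑ ^ 2)) (s, y))
    hm
  calc ∫⁻ s, ‖decayConv l g s‖ₑ ^ 2 ∂kernelMeasure κ
      = ∫⁻ s in Ioi 0, ENNReal.ofReal (κ s) * ‖decayConv l g s‖ₑ ^ 2 := hκ.lintegral_eq _
    _ ≤ ∫⁻ s in Ioi 0, ENNReal.ofReal l⁻¹ * ∫⁻ y, {q : ℝ × ℝ | q.2 ≤ q.1}.indicator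
          (fun q => ENNReal.ofReal (κ q.1) * (w q.1 q.2 * ‖g q.2‖ₑ ^ 2)) (s, y) ∂ν := by
        refine setLIntegral_mono' measurableSet_Ioi fun s hs => ?_
        refine (mul_le_mul_right (enorm_decayConv_sq_le hl hg hs) _).trans_eq ?_
        rw [mul_left_comm, ← lintegral_const_mul' _ _ ENNReal.ofReal_ne_top]
        have e : (fun y => {q : ℝ × ℝ | q.2 ≤ q.1}.indicator
          (fun q => ENNReal.ofReal (κ q.1) * (w q.1 q.2 * ‖g q.2‖ₑ ^ 2)) (s, y))
          = (Iic s).indicator fun y => ENNReal.ofReal (κ s) * (w s y * ‖g y‖ₑ ^ 2) := rfl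
        rw [e, lintegral_indicator measurableSet_Iic, hν,
          Measure.restrict_restrict measurableSet_Iic, inter_comm, Ioi_inter_Iic]
    _ = ENNReal.ofReal l⁻¹ * ∫⁻ y in Ioi 0, ∫⁻ s, {q : ℝ × ℝ | q.2 ≤ q.1}.indicator
          (fun q => ENNReal.ofReal (κ q.1) * (w q.1 q.2 * ‖g q.2‖ₑ ^ 2)) (s, y) ∂ν := by
        rw [lintegral_const_mul' _ _ ENNReal.ofReal_ne_top, hswap]
    _ ≤ ENNReal.ofReal l⁻¹ * ∫⁻ y in Ioi 0,
          ENNReal.ofReal l⁻¹ * (ENNReal.ofReal (κ y) * ‖g y‖ₑ ^ 2) := by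
        refine mul_le_mul_right (setLIntegral_mono' measurableSet_Ioi fun y hy => ?_) _
        have hy0 : 0 < y := hy
        have e : (fun s => {q : ℝ × ℝ | q.2 ≤ q.1}.indicator
          (fun q => ENNReal.ofReal (κ q.1) * (w q.1 q.2 * ‖g q.2‖ₑ ^ 2)) (s, y))
          = (Ici y).indicator fun s => ENNReal.ofReal (κ s) * (w s y * ‖g y‖ₑ ^ 2) := rfl
        have e2 : Ici y ∩ Ioi 0 = Ici y :=
          inter_eq_left.2 fun s hs => mem_Ioi.2 (hy0.trans_le hs)
        rw [e, lintegral_indicator measurableSet_Ici, hν,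
          Measure.restrict_restrict measurableSet_Ici, e2, ← lintegral_exp_Ioi hl y,
          setLIntegral_congr Ioi_ae_eq_Ici, ← lintegral_mul_const'' _ (by fun_prop)]
        refine setLIntegral_mono' measurableSet_Ici fun s hs => ?_
        rw [mul_left_comm]
        refine mul_le_mul_right (mul_le_mul_left (ENNReal.ofReal_le_ofReal ?_) _) _
        exact hκ.antitoneOn hy0.le (hy0.le.trans hs) hs
    _ = ENNReal.ofReal l⁻¹ ^ 2 * ∫⁻ s, ‖g s‖ₑ ^ 2 ∂kernelMeasure κ := by
        rw [lintegral_const_mul' _ _ ENNReal.ofReal_ne_top, ← mul_assoc, ← sq, ← hκ.lintegral_eq]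

theorem stronglyMeasurable_decayConv [NormedSpace ℝ F] (l : ℝ) {g : ℝ → F}
    (hg : StronglyMeasurable g) :
    StronglyMeasurable fun s => ∫ y in Ioc 0 s, Real.exp (-(l * (s - y))) • g y := by
  have hmeas : MeasurableSet {q : ℝ × ℝ | q.2 ∈ Ioc 0 q.1} :=
    (measurableSet_lt measurable_const measurable_snd).inter
      (measurableSet_le measurable_snd measurable_fst)
  have h1 : StronglyMeasurable ({q : ℝ × ℝ | q.2 ∈ Ioc 0 q.1}.indicator
      fun q => Real.exp (-(l * (q.1 - q.2))) • g q.2) := by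
    refine StronglyMeasurable.indicator (StronglyMeasurable.smul ?_ (hg.comp_measurable measurable_snd)) hmeas
    exact Continuous.stronglyMeasurable (by fun_prop)
  have h2 := h1.integral_prod_right' (ν := volume)
  refine (congrArg StronglyMeasurable (funext fun s => ?_)).mp h2
  have e : (fun y => {q : ℝ × ℝ | q.2 ∈ Ioc 0 q.1}.indicator
      (fun q => Real.exp (-(l * (q.1 - q.2))) • g q.2) (s, y))
      = (Ioc 0 s).indicator fun y => Real.exp (-(l * (s - y))) • g y := rfl
  rw [e, integral_indicator measurableSet_Ioc]

/-- The constant function `v` as an element of the memory space. -/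
noncomputable def constMem (hκ : IsMemoryKernel κ δ) (v : F) : MemorySpace κ F :=
  have := hκ.isFiniteMeasure
  (memLp_const v).toLp (fun _ => v)

theorem constMem_ae (hκ : IsMemoryKernel κ δ) (v : F) :
    ∀ᵐ s ∂kernelMeasure κ, constMem hκ v s = v :=
  have := hκ.isFiniteMeasure
  (memLp_const v).coeFn_toLp

theorem eq_constMem (hκ : IsMemoryKernel κ δ) {v : F} {ζ : MemorySpace κ F}
    (h : ∀ᵐ s ∂kernelMeasure κ, ζ s = v) : ζ = constMem hκ v := by
  refine Lp.ext ?_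
  filter_upwards [h, constMem_ae hκ v] with s h1 h2
  rw [h1, h2]

variable [NormedSpace ℝ F]

/-- The resolvent of the derivative on the memory space, and its bound. -/
theorem IsMemoryKernel.exists_resolvent (hκ : IsMemoryKernel κ δ) {l : ℝ} (hl : 0 < l)
    (g : MemorySpace κ F) : ∃ η : MemorySpace κ F,
      (∀ᵐ s ∂kernelMeasure κ, η s = decayConv l g s) ∧ l * ‖η‖ ≤ ‖g‖ := by
  have hae : (fun s => ∫ y in Ioc 0 s, Real.exp (-(l * (s - y))) • g y)
      =ᵐ[kernelMeasure κ] decayConv l g := by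
    filter_upwards [hκ.ae_pos] with s hs
    rw [decayConv, intervalIntegral.integral_of_le hs.1.le]
  have hm : AEStronglyMeasurable (decayConv l g) (kernelMeasure κ) :=
    (stronglyMeasurable_decayConv l (Lp.stronglyMeasurable g)).aestronglyMeasurable.congr hae
  have hn : eLpNorm (decayConv l g) 2 (kernelMeasure κ) ≤ ENNReal.ofReal l⁻¹ * ‖g‖ₑ := by
    have h1 := hκ.lintegral_decayConv_le hl (Lp.stronglyMeasurable g)
    rw [Lp.enorm_def, eLpNorm_eq_lintegral_rpow_enorm_toReal two_ne_zero ENNReal.ofNat_ne_top,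
      eLpNorm_eq_lintegral_rpow_enorm_toReal two_ne_zero ENNReal.ofNat_ne_top]
    simp only [ENNReal.toReal_ofNat, ENNReal.rpow_two]
    have h2 := ENNReal.rpow_le_rpow h1 (by norm_num : (0 : ℝ) ≤ 1 / 2)
    refine h2.trans_eq ?_
    rw [ENNReal.mul_rpow_of_nonneg _ _ (by norm_num), ← ENNReal.rpow_two, ← ENNReal.rpow_mul]
    norm_num
  have hmem : MemLp (decayConv l g) 2 (kernelMeasure κ) :=
    ⟨hm, hn.trans_lt (ENNReal.mul_lt_top ENNReal.ofReal_lt_top enorm_lt_top)⟩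
  refine ⟨hmem.toLp _, hmem.coeFn_toLp, ?_⟩
  have h3 : ‖hmem.toLp _‖ₑ ≤ ENNReal.ofReal l⁻¹ * ‖g‖ₑ := by
    rwa [Lp.enorm_toLp]
  rw [← ofReal_norm, ← ofReal_norm, ← ENNReal.ofReal_mul (by positivity),
    ENNReal.ofReal_le_ofReal_iff (by positivity), inv_mul_eq_div, le_div_iff₀ hl, mul_comm] at h3
  exact h3

/-- `η` is represented by `∫₀ˢ ζ` on the set where the kernel is positive, and the same holds inside
integrals. -/
theorem IsMemoryKernel.integral_congr (hκ : IsMemoryKernel κ δ) {f g : ℝ → F}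
    (h : f =ᵐ[kernelMeasure κ] g) {s : ℝ} (hs0 : 0 ≤ s) (hs : 0 < κ s) :
    ∫ y in (0 : ℝ)..s, f y = ∫ y in (0 : ℝ)..s, g y := by
  rw [intervalIntegral.integral_of_le hs0, intervalIntegral.integral_of_le hs0]
  exact integral_congr_ae (hκ.ae_Ioc h hs)

theorem IsMemoryKernel.exists_hasMemoryDeriv [CompleteSpace F] (hκ : IsMemoryKernel κ δ) (g : MemorySpace κ F) :
    ∃ η : MemorySpace κ F, HasMemoryDeriv η (g - η) := by
  obtain ⟨η, hη, -⟩ := hκ.exists_resolvent one_pos g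
  refine ⟨η, ?_⟩
  unfold HasMemoryDeriv
  filter_upwards [hη, hκ.ae_pos] with s hs1 hs
  rw [hs1, decayConv_eq_integral 1 hs.1.le (hκ.intervalIntegrable (hκ.integrable g) hs.1.le hs.2)]
  refine hκ.integral_congr ?_ hs.1.le hs.2
  filter_upwards [hη, Lp.coeFn_sub g η] with y hy1 hy2
  rw [hy2, Pi.sub_apply, hy1, one_smul]

/-- `η` is the resolvent applied to `l η + ζ`, so the Schur bound applies to it. This is
dissipativity of `-∂ₛ` in norm form. -/
theorem HasMemoryDeriv.mul_norm_le [CompleteSpace F] (hκ : IsMemoryKernel κ δ) {η ζ : MemorySpace κ F}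
    (h : HasMemoryDeriv η ζ) {l : ℝ} (hl : 0 < l) : l * ‖η‖ ≤ ‖l • η + ζ‖ := by
  obtain ⟨η', hη', hn⟩ := hκ.exists_resolvent hl (l • η + ζ)
  have : η' = η := by
    refine Lp.ext ?_
    filter_upwards [hη', h, hκ.ae_pos] with s hs1 hs2 hs
    rw [hs1, hs2, primitive_eq_decayConv l hs.1.le
      (hκ.intervalIntegrable (hκ.integrable ζ) hs.1.le hs.2)]
    refine hκ.integral_congr ?_ hs.1.le hs.2
    filter_upwards [Lp.coeFn_add (l • η) ζ, Lp.coeFn_smul l η, h] with y h1 h2 h3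
    rw [h1, Pi.add_apply, h2, Pi.smul_apply, h3]
  rwa [this] at hn

theorem HasMemoryDeriv.zero (hκ : IsMemoryKernel κ δ) :
    HasMemoryDeriv (0 : MemorySpace κ F) 0 := by
  unfold HasMemoryDeriv
  filter_upwards [Lp.coeFn_zero F 2 (kernelMeasure κ), hκ.ae_pos] with s h1 hs
  rw [h1, hκ.integral_congr (Lp.coeFn_zero F 2 (kernelMeasure κ)) hs.1.le hs.2]
  simp

theorem HasMemoryDeriv.add (hκ : IsMemoryKernel κ δ) {η ζ η' ζ' : MemorySpace κ F}
    (h : HasMemoryDeriv η ζ) (h' : HasMemoryDeriv η' ζ') : HasMemoryDeriv (η + η') (ζ + ζ') := by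
  unfold HasMemoryDeriv at *
  filter_upwards [h, h', Lp.coeFn_add η η', hκ.ae_pos] with s h1 h2 h3 hs
  rw [h3, Pi.add_apply, h1, h2, ← intervalIntegral.integral_add
    (hκ.intervalIntegrable (hκ.integrable ζ) hs.1.le hs.2)
    (hκ.intervalIntegrable (hκ.integrable ζ') hs.1.le hs.2)]
  exact hκ.integral_congr (Lp.coeFn_add ζ ζ').symm hs.1.le hs.2

theorem HasMemoryDeriv.smul (hκ : IsMemoryKernel κ δ) {η ζ : MemorySpace κ F} (c : ℝ)
    (h : HasMemoryDeriv η ζ) : HasMemoryDeriv (c • η) (c • ζ) := by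
  unfold HasMemoryDeriv at *
  filter_upwards [h, Lp.coeFn_smul c η, hκ.ae_pos] with s h1 h3 hs
  rw [h3, Pi.smul_apply, h1, ← intervalIntegral.integral_smul]
  exact hκ.integral_congr (Lp.coeFn_smul c ζ).symm hs.1.le hs.2

theorem HasMemoryDeriv.ae_eq_smul [CompleteSpace F] (hκ : IsMemoryKernel κ δ) {v : F} {η : MemorySpace κ F}
    (h : HasMemoryDeriv η (constMem hκ v)) : ∀ᵐ s ∂kernelMeasure κ, η s = s • v := by
  filter_upwards [h, hκ.ae_pos] with s h1 hs
  rw [h1, hκ.integral_congr (constMem_ae hκ v) hs.1.le hs.2]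
  simp

/-- The solution `η(s) = (1 - e^{-s}) v` of `η + η_s = v`, `η(0) = 0`, and its mean value. -/
theorem exists_hasMemoryDeriv_const [CompleteSpace F] (hκ : IsMemoryKernel κ δ) : ∃ c : ℝ, 0 ≤ c ∧
    ((∃ s, 0 < s ∧ 0 < κ s) → 0 < c) ∧ ∀ v : F, ∃ η : MemorySpace κ F,
      HasMemoryDeriv η (constMem hκ v - η) ∧ ∫ s, η s ∂kernelMeasure κ = c • v := by
  have := hκ.isFiniteMeasure
  have hb : ∀ s ∈ {s : ℝ | 0 < s}, ‖1 - Real.exp (-s)‖ ≤ 1 := by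
    intro s hs
    have hs0 : 0 < s := hs
    have h1 := Real.exp_pos (-s)
    have h2 : Real.exp (-s) ≤ 1 := Real.exp_le_one_iff.2 (by linarith)
    rw [Real.norm_eq_abs, abs_le]
    constructor <;> linarith
  have hθ : Integrable (fun s => 1 - Real.exp (-s)) (kernelMeasure κ) := by
    refine Integrable.mono' (integrable_const (1 : ℝ))
      (Continuous.aestronglyMeasurable (by fun_prop)) ?_
    filter_upwards [hκ.ae_pos] with s hs using hb s hs.1
  have hnn : 0 ≤ᵐ[kernelMeasure κ] fun s => 1 - Real.exp (-s) := by
    filter_upwards [hκ.ae_pos] with s hs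
    have h2 : Real.exp (-s) ≤ 1 := Real.exp_le_one_iff.2 (by linarith)
    exact sub_nonneg.2 h2
  refine ⟨∫ s, (1 - Real.exp (-s)) ∂kernelMeasure κ, integral_nonneg_of_ae hnn, ?_, fun v => ?_⟩
  · rintro ⟨t, ht, hkt⟩
    rw [integral_pos_iff_support_of_nonneg_ae hnn hθ]
    have h1 : Ioc 0 t ⊆ Function.support fun s => 1 - Real.exp (-s) := by
      intro s hs
      have : Real.exp (-s) < 1 := Real.exp_lt_one_iff.2 (by linarith [hs.1])
      exact (sub_pos.2 this).ne'
    refine lt_of_lt_of_le ?_ (measure_mono h1)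
    rw [pos_iff_ne_zero]
    intro h0
    -- If `(0, t]` had kernel measure zero, domination of Lebesgue measure would make its length
    -- zero too.
    have h2 := Measure.le_iff'.1 (hκ.restrict_le hkt) (Ioc 0 t)
    rw [Measure.smul_apply, h0, smul_zero, Measure.restrict_apply_self, Real.volume_Ioc] at h2
    simp at h2
    linarith
  · have hmem : MemLp (fun s => (1 - Real.exp (-s)) • v) 2 (kernelMeasure κ) := by
      refine MemLp.of_bound (Continuous.aestronglyMeasurable (by fun_prop)) ‖v‖ ?_
      filter_upwards [hκ.ae_pos] with s hs
      rw [norm_smul]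
      exact mul_le_of_le_one_left (norm_nonneg _) (hb s hs.1)
    refine ⟨hmem.toLp _, ?_, ?_⟩
    · unfold HasMemoryDeriv
      filter_upwards [hmem.coeFn_toLp, hκ.ae_pos] with s h1 hs
      have h2 : ∫ y in (0 : ℝ)..s, (constMem hκ v - hmem.toLp _ : MemorySpace κ F) y
          = ∫ y in (0 : ℝ)..s, Real.exp (-y) • v := by
        refine hκ.integral_congr ?_ hs.1.le hs.2
        filter_upwards [hmem.coeFn_toLp, constMem_ae hκ v,
          Lp.coeFn_sub (constMem hκ v) (hmem.toLp _)] with y h1 h2 h3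
        rw [h3, Pi.sub_apply, h1, h2, sub_smul, one_smul, sub_sub_cancel]
      rw [h1, h2, intervalIntegral.integral_smul_const]
      congr 1
      rw [intervalIntegral.integral_comp_neg (fun y => Real.exp y)]
      simp
    · rw [integral_congr_ae hmem.coeFn_toLp, integral_smul_const]

end Memory

section MemoryInner

variable {κ : ℝ → ℝ} {δ : ℝ} {F : Type*} [NormedAddCommGroup F] [InnerProductSpace ℝ F]

/-- Squaring `l‖η‖ ≤ ‖lη + ζ‖` gives `-‖ζ‖² ≤ 2 l (ζ, η)` for every `l > 0`, which is impossible for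
large `l` if `(ζ, η) < 0`. This route avoids boundary terms at the end of the kernel's support. -/
theorem HasMemoryDeriv.inner_nonneg [CompleteSpace F] (hκ : IsMemoryKernel κ δ)
    {η ζ : MemorySpace κ F} (h : HasMemoryDeriv η ζ) : 0 ≤ inner ℝ ζ η := by
  by_contra! hneg
  have h1 : ∀ l : ℝ, 0 < l → -‖ζ‖ ^ 2 ≤ 2 * l * inner ℝ ζ η := by
    intro l hl
    have h2 := h.mul_norm_le hκ hl
    have h3 := pow_le_pow_left₀ (by positivity) h2 2
    rw [norm_add_sq_real, norm_smul, Real.norm_of_nonneg hl.le, real_inner_smul_left,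
      real_inner_comm] at h3
    linarith
  have h2 := h1 ((‖ζ‖ ^ 2 + 1) / (-(2 * inner ℝ ζ η))) (div_pos (by positivity) (by linarith))
  have h3 : 2 * ((‖ζ‖ ^ 2 + 1) / (-(2 * inner ℝ ζ η))) * inner ℝ ζ η = -(‖ζ‖ ^ 2 + 1) := by
    field_simp [hneg.ne]
  linarith

theorem inner_constMem [CompleteSpace F] (hκ : IsMemoryKernel κ δ) (v : F) (η : MemorySpace κ F) :
    inner ℝ (constMem hκ v) η = inner ℝ v (∫ s, η s ∂kernelMeasure κ) := by
  rw [L2.inner_def, ← integral_inner (hκ.integrable η)]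
  refine integral_congr_ae ?_
  filter_upwards [constMem_ae hκ v] with s hs
  rw [hs]

end MemoryInner

end Plate

namespace Plate

section MemoryZero

variable {κ : ℝ → ℝ} {δ : ℝ} {F : Type*} [NormedAddCommGroup F]

theorem constMem_add (hκ : IsMemoryKernel κ δ) (v w : F) :
    constMem hκ (v + w) = constMem hκ v + constMem hκ w := by
  refine (eq_constMem hκ ?_).symm
  filter_upwards [Lp.coeFn_add (constMem hκ v) (constMem hκ w), constMem_ae hκ v,
    constMem_ae hκ w] with s h1 h2 h3
  rw [h1, Pi.add_apply, h2, h3]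

theorem constMem_zero (hκ : IsMemoryKernel κ δ) : constMem hκ (0 : F) = 0 :=
  (eq_constMem hκ (Lp.coeFn_zero F 2 (kernelMeasure κ))).symm

variable [NormedSpace ℝ F]

theorem constMem_smul (hκ : IsMemoryKernel κ δ) (c : ℝ) (v : F) :
    constMem hκ (c • v) = c • constMem hκ v := by
  refine (eq_constMem hκ ?_).symm
  filter_upwards [Lp.coeFn_smul c (constMem hκ v), constMem_ae hκ v] with s h1 h2
  rw [h1, Pi.smul_apply, h2]

/-- The primitive of `ζ` vanishes almost everywhere, hence by continuity everywhere on `[0, t]`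
whenever `κ t > 0`; Lebesgue differentiation then gives `ζ = 0`. -/
theorem HasMemoryDeriv.eq_zero [CompleteSpace F] (hκ : IsMemoryKernel κ δ) {ζ : MemorySpace κ F}
    (h : HasMemoryDeriv 0 ζ) : ζ = 0 := by
  have h0 : ∀ᵐ s ∂kernelMeasure κ, ∫ y in (0 : ℝ)..s, ζ y = 0 := by
    filter_upwards [h, Lp.coeFn_zero F 2 (kernelMeasure κ)] with s h1 h2
    rw [← h1, h2, Pi.zero_apply]
  have hint : ∀ t, 0 ≤ t → 0 < κ t → IntervalIntegrable ζ volume 0 t := fun t ht hkt =>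
    hκ.intervalIntegrable (hκ.integrable ζ) ht hkt
  have h1 : ∀ t, 0 < t → 0 < κ t → ∀ s ∈ Icc 0 t, ∫ y in (0 : ℝ)..s, ζ y = 0 := by
    intro t ht hkt
    have hc : ContinuousOn (fun s => ∫ y in (0 : ℝ)..s, ζ y) (Icc 0 t) := by
      have := intervalIntegral.continuousOn_primitive_interval (μ := volume)
        ((hint t ht.le hkt).def'.congr_set_ae
          (by rw [uIoc_of_le ht.le, uIcc_of_le ht.le]; exact Ioc_ae_eq_Icc.symm))
      rwa [uIcc_of_le ht.le] at this
    have h2 := Measure.eqOn_of_ae_eq (f := fun s => ∫ y in (0 : ℝ)..s, ζ y) (g := fun _ => 0)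
      (μ := volume) (s := Icc 0 t) (by
        rw [← restrict_Ioc_eq_restrict_Icc]
        exact hκ.ae_Ioc h0 hkt) hc continuousOn_const (by
        rw [interior_Icc, closure_Ioo ht.ne])
    exact h2
  -- Rational right endpoints keep the union of exceptional null sets countable; continuity of `κ`
  -- later supplies such an endpoint to the right of any `s` with `κ s > 0`.
  have h2 : ∀ q : ℚ, 0 < (q : ℝ) → 0 < κ q → ∀ᵐ s, s ∈ Ioo 0 (q : ℝ) → ζ s = 0 := by
    intro q hq hkq
    filter_upwards [(hint q hq.le hkq).ae_hasDerivAt_integral] with s hs hsq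
    have h3 := hs (by rw [uIcc_of_le hq.le]; exact Ioo_subset_Icc_self hsq) 0 left_mem_uIcc
    have h4 : (fun x => ∫ y in (0 : ℝ)..x, ζ y) =ᶠ[𝓝 s] fun _ => 0 := by
      filter_upwards [Ioo_mem_nhds hsq.1 hsq.2] with x hx
      exact h1 q hq hkq x (Ioo_subset_Icc_self hx)
    exact (h3.congr_of_eventuallyEq h4.symm).unique (hasDerivAt_const s (0 : F))
  have hae : ζ =ᵐ[kernelMeasure κ] 0 := by
    refine hκ.ae_iff.2 ?_
    have h3 := ae_all_iff.2 fun q : ℚ => eventually_imp_distrib_left.2 fun hq =>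
      eventually_imp_distrib_left.2 (h2 q hq)
    filter_upwards [h3] with s hs hs0 hks
    have h4 : ∀ᶠ t in 𝓝[>] s, 0 < κ t := by
      have h5 := (hκ.continuousOn s hs0.le).mono (Ioi_subset_Ici hs0.le)
      exact h5.eventually (lt_mem_nhds hks)
    obtain ⟨t, ht, hst⟩ := (h4.and self_mem_nhdsWithin).exists
    have hst' : s < t := hst
    obtain ⟨q, hsq, hqt⟩ := exists_rat_btwn hst'
    exact hs q (hs0.trans hsq) (hκ.pos_of_le ht (hs0.trans hsq).le hqt.le) ⟨hs0, hsq⟩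
  exact Lp.ext (hae.trans (Lp.coeFn_zero F 2 (kernelMeasure κ)).symm)

end MemoryZero

/-! ### Weak solutions of the stationary system -/

/-- Lax–Milgram on `V × W`. The two `ν`-terms are skew and cancel on the diagonal, so the form is
coercive with constant `min α γ`, whatever the size of `ν`. -/
theorem exists_weak_solution {V W H : Type*} [NormedAddCommGroup V] [InnerProductSpace ℝ V]
    [CompleteSpace V] [NormedAddCommGroup W] [InnerProductSpace ℝ W] [CompleteSpace W]
    [NormedAddCommGroup H] [InnerProductSpace ℝ H] (i : V →L[ℝ] H) (j : W →L[ℝ] H)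
    (p : V →L[ℝ] H) {α γ : ℝ} (hα : 0 < α) (hγ : 0 < γ) (ν : ℝ) (f : V →L[ℝ] ℝ) (g : W →L[ℝ] ℝ) :
    ∃ w v, (∀ φ, inner ℝ (i w) (i φ) + α * inner ℝ w φ - ν * inner ℝ (j v) (p φ) = f φ) ∧
      ∀ ψ, inner ℝ (j v) (j ψ) + γ * inner ℝ v ψ + ν * inner ℝ (p w) (j ψ) = g ψ := by
  let bV : V →L[ℝ] V →L[ℝ] ℝ := innerSL ℝ
  let bW : W →L[ℝ] W →L[ℝ] ℝ := innerSL ℝ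
  let bH : H →L[ℝ] H →L[ℝ] ℝ := innerSL ℝ
  let p₁ : WithLp 2 (V × W) →L[ℝ] V := WithLp.fstL 2 ℝ V W
  let p₂ : WithLp 2 (V × W) →L[ℝ] W := WithLp.sndL 2 ℝ V W
  let B : WithLp 2 (V × W) →L[ℝ] WithLp 2 (V × W) →L[ℝ] ℝ :=
    bH.bilinearComp (i ∘L p₁) (i ∘L p₁) + α • bV.bilinearComp p₁ p₁
      - ν • bH.bilinearComp (j ∘L p₂) (p ∘L p₁) + bH.bilinearComp (j ∘L p₂) (j ∘L p₂)
      + γ • bW.bilinearComp p₂ p₂ + ν • bH.bilinearComp (p ∘L p₁) (j ∘L p₂)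
  have hB : ∀ x y : WithLp 2 (V × W), B x y =
      inner ℝ (i x.fst) (i y.fst) + α * inner ℝ x.fst y.fst - ν * inner ℝ (j x.snd) (p y.fst)
      + inner ℝ (j x.snd) (j y.snd) + γ * inner ℝ x.snd y.snd + ν * inner ℝ (p x.fst) (j y.snd) :=
    fun x y => rfl
  have hco : IsCoercive B := by
    refine ⟨min α γ, lt_min hα hγ, fun x => ?_⟩
    rw [hB, mul_assoc, ← sq, WithLp.prod_norm_sq_eq_of_L2]
    simp only [real_inner_self_eq_norm_sq, real_inner_comm (p x.fst)]
    have h1 := mul_le_mul_of_nonneg_right (min_le_left α γ) (sq_nonneg ‖x.fst‖)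
    have h2 := mul_le_mul_of_nonneg_right (min_le_right α γ) (sq_nonneg ‖x.snd‖)
    have h3 := sq_nonneg ‖i x.fst‖
    have h4 := sq_nonneg ‖j x.snd‖
    linarith
  let z := (InnerProductSpace.toDual ℝ (WithLp 2 (V × W))).symm (f ∘L p₁ + g ∘L p₂)
  let x := hco.continuousLinearEquivOfBilin.symm z
  have hx : ∀ y : WithLp 2 (V × W), B x y = f y.fst + g y.snd := by
    intro y
    rw [← hco.continuousLinearEquivOfBilin_apply, ContinuousLinearEquiv.apply_symm_apply,
      InnerProductSpace.toDual_symm_apply]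
    rfl
  refine ⟨x.fst, x.snd, fun φ => ?_, fun ψ => ?_⟩
  · have h := hx (WithLp.toLp 2 (φ, 0))
    rw [hB] at h
    simpa using h
  · have h := hx (WithLp.toLp 2 (0, ψ))
    rw [hB] at h
    simpa using h

theorem integral_smul_innerSL_apply {κ : ℝ → ℝ} {δ : ℝ} (hκ : IsMemoryKernel κ δ) {F : Type*}
    [NormedAddCommGroup F] [InnerProductSpace ℝ F] [CompleteSpace F] (η : MemorySpace κ F) (φ : F) :
    (∫ r in Ioi (0 : ℝ), κ r • (innerSL ℝ (η r) : StrongDual ℝ F)) φ =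
      inner ℝ (∫ r, η r ∂kernelMeasure κ) φ := by
  let b : F →L[ℝ] F →L[ℝ] ℝ := innerSL ℝ
  rw [← hκ.integral_eq]
  exact DFunLike.congr_fun (b.integral_comp_comm (hκ.integrable η)) φ

namespace DiagOp

variable {H : Type*} [NormedAddCommGroup H] [InnerProductSpace ℝ H] (A : DiagOp H)

theorem inner_pow (s : ℝ≥0) (u v : A.Space s) :
    inner ℝ (A.pow s u) (A.pow s v) = inner ℝ u v := (A.pow s).inner_map_map u v

theorem e_mem_dom (s : ℝ≥0) (k : ℕ) : A.e k ∈ A.dom s := by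
  refine (A.summable_iff_memlp s _).2 ?_
  refine ((lp.memℓp (A.e.repr (A.e k))).norm.const_smul (A.ev k ^ (s : ℝ))).mono fun j => ?_
  rcases eq_or_ne j k with rfl | h
  · rw [norm_mul, Real.norm_of_nonneg (Real.rpow_pos_of_pos (A.ev_pos j) _).le]
    rfl
  · simp [HilbertBasis.repr_self, lp.single_apply, h]

theorem eq_zero_of_inner_eq_zero {s : ℝ≥0} {g : H}
    (h : ∀ φ : A.Space s, inner ℝ g (φ.1 : H) = 0) : g = 0 := by
  apply A.e.repr.injective
  ext k
  rw [A.e.repr_apply_apply, real_inner_comm, map_zero]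
  exact h ⟨A.e k, A.e_mem_dom s k⟩

/-- Since `A^s` is an isometry, the functional `A^s(A^s u)` on `F_s` is the Riesz functional of `u`.
The `F_{-s}`-valued memory integral thus becomes a Bochner integral in `F_s`. -/
theorem integral_powNeg [CompleteSpace H] {κ : ℝ → ℝ} {δ : ℝ} (hκ : IsMemoryKernel κ δ) (s : ℝ≥0)
    (η : MemorySpace κ (A.Space s)) (φ : A.Space s) :
    (∫ r in Ioi (0 : ℝ), κ r • A.powNeg s (A.pow s (η r))) φ =
      inner ℝ (∫ r, η r ∂kernelMeasure κ) φ := by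
  have hb : ∀ u, A.powNeg s (A.pow s u) = innerSL ℝ u := fun u => by
    ext φ
    exact A.inner_pow s u φ
  simp only [hb]
  exact integral_smul_innerSL_apply hκ η φ

end DiagOp

end Plate

namespace Plate

/-! ### The generator of the linear plate model -/

theorem integral_add_mem {κ : ℝ → ℝ} {δ : ℝ} (hκ : IsMemoryKernel κ δ) {F : Type*}
    [NormedAddCommGroup F] [NormedSpace ℝ F] (η η' : MemorySpace κ F) :
    ∫ s, (η + η') s ∂kernelMeasure κ =
      (∫ s, η s ∂kernelMeasure κ) + ∫ s, η' s ∂kernelMeasure κ := by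
  rw [integral_congr_ae (Lp.coeFn_add η η')]
  exact integral_add (hκ.integrable η) (hκ.integrable η')

theorem integral_smul_mem {κ : ℝ → ℝ} {F : Type*}
    [NormedAddCommGroup F] [NormedSpace ℝ F] (c : ℝ) (η : MemorySpace κ F) :
    ∫ s, (c • η) s ∂kernelMeasure κ = c • ∫ s, η s ∂kernelMeasure κ := by
  rw [integral_congr_ae (Lp.coeFn_smul c η)]
  exact integral_smul c η

theorem integral_zero_mem {κ : ℝ → ℝ} {F : Type*} [NormedAddCommGroup F] [NormedSpace ℝ F] :
    ∫ s, (0 : MemorySpace κ F) s ∂kernelMeasure κ = 0 := by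
  rw [integral_congr_ae (Lp.coeFn_zero F 2 (kernelMeasure κ))]
  simp

namespace PlateData

variable {H : Type*} [NormedAddCommGroup H] [InnerProductSpace ℝ H] (P : PlateData H)

theorem state_inj {u u' : P.F1} {w w' v v' : H} {a a' : MemorySpace P.μ₁ P.F1}
    {b b' : MemorySpace P.μ₂ P.Fhalf} (h : P.state u w v a b = P.state u' w' v' a' b') :
    u = u' ∧ w = w' ∧ v = v' ∧ a = a' ∧ b = b' :=
  ⟨congrArg (fun U : P.Phase => U.fst) h, congrArg (fun U : P.Phase => U.snd.fst) h,
    congrArg (fun U : P.Phase => U.snd.snd.fst) h, congrArg (fun U : P.Phase => U.snd.snd.snd.fst) h,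
    congrArg (fun U : P.Phase => U.snd.snd.snd.snd) h⟩

theorem inner_state (u u' : P.F1) (w w' v v' : H) (a a' : MemorySpace P.μ₁ P.F1)
    (b b' : MemorySpace P.μ₂ P.Fhalf) : inner ℝ (P.state u w v a b) (P.state u' w' v' a' b') =
      inner ℝ u u' + (inner ℝ w w' + (inner ℝ v v' + (inner ℝ a a' + inner ℝ b b'))) := rfl

theorem state_sub (u u' : P.F1) (w w' v v' : H) (a a' : MemorySpace P.μ₁ P.F1)
    (b b' : MemorySpace P.μ₂ P.Fhalf) : P.state u w v a b - P.state u' w' v' a' b' =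
      P.state (u - u') (w - w') (v - v') (a - a') (b - b') := rfl

/-- The change of coordinates `u ↦ √β u`, which makes the linear part dissipative. -/
noncomputable def rescale (hβ : 0 < P.β) : P.Phase ≃L[ℝ] P.Phase :=
  ((WithLp.prodContinuousLinearEquiv 2 ℝ _ _).trans
    (((ContinuousLinearEquiv.smulLeft (Units.mk0 (√P.β) (Real.sqrt_pos.2 hβ).ne')).prodCongr
      (ContinuousLinearEquiv.refl ℝ _)))).trans (WithLp.prodContinuousLinearEquiv 2 ℝ _ _).symm

theorem rescale_state (hβ : 0 < P.β) (u : P.F1) (w v : H) (a : MemorySpace P.μ₁ P.F1)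
    (b : MemorySpace P.μ₂ P.Fhalf) :
    P.rescale hβ (P.state u w v a b) = P.state (√P.β • u) w v a b := rfl

variable [CompleteSpace H] {δ₁ δ₂ : ℝ}

/-- The equations of the linear part, tested against elements of `F_1` and `F_{1/2}`. -/
theorem isLinearPart_iff (hμ₁ : IsMemoryKernel P.μ₁ δ₁) (hμ₂ : IsMemoryKernel P.μ₂ δ₂)
    (U V : P.Phase) : P.IsLinearPart U V ↔
    ∃ (u w : P.F1) (v : P.Fhalf) (ηbar ζbar : MemorySpace P.μ₁ P.F1)
      (η ζ : MemorySpace P.μ₂ P.Fhalf) (w' v' : H),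
      U = P.state u w.1 v.1 ηbar η ∧
      V = P.state w w' v' (constMem hμ₁ w - ζbar) (constMem hμ₂ v - ζ) ∧
      HasMemoryDeriv ηbar ζbar ∧ HasMemoryDeriv η ζ ∧
      (∀ φ : P.F1, inner ℝ w' (φ.1 : H) = -(P.β * inner ℝ u φ)
        - inner ℝ (∫ s, ηbar s ∂kernelMeasure P.μ₁) φ + P.ν * inner ℝ (v.1 : H) (P.A.pow 1 φ)) ∧
      ∀ ψ : P.Fhalf, inner ℝ v' (ψ.1 : H) + P.ν * inner ℝ (P.A.pow 1 w) (ψ.1 : H) =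
        -(P.ω * inner ℝ v ψ) - inner ℝ (∫ s, η s ∂kernelMeasure P.μ₂) ψ := by
  have h1 : ∀ (u : P.F1) (v : P.Fhalf) (ηbar : MemorySpace P.μ₁ P.F1) (w' : H),
      (P.A.embNeg 1 w' = -(P.β • P.A.powNeg 1 (P.A.pow 1 u))
        - (∫ s in Ioi (0 : ℝ), P.μ₁ s • P.A.powNeg 1 (P.A.pow 1 (ηbar s)))
        + P.ν • P.A.powNeg 1 v.1) ↔
      ∀ φ : P.F1, inner ℝ w' (φ.1 : H) = -(P.β * inner ℝ u φ)
        - inner ℝ (∫ s, ηbar s ∂kernelMeasure P.μ₁) φ + P.ν * inner ℝ (v.1 : H) (P.A.pow 1 φ) := by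
    intro u v ηbar w'
    rw [ContinuousLinearMap.ext_iff]
    refine forall_congr' fun φ => ?_
    rw [← P.A.integral_powNeg hμ₁, ← P.A.inner_pow 1 u φ]
    rfl
  have h2 : ∀ (w : P.F1) (v : P.Fhalf) (η : MemorySpace P.μ₂ P.Fhalf) (v' : H),
      (P.A.embNeg (1 / 2) (v' + P.ν • P.A.pow 1 w) =
        -(P.ω • P.A.powNeg (1 / 2) (P.A.pow (1 / 2) v))
        - (∫ s in Ioi (0 : ℝ), P.μ₂ s • P.A.powNeg (1 / 2) (P.A.pow (1 / 2) (η s)))) ↔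
      ∀ ψ : P.Fhalf, inner ℝ v' (ψ.1 : H) + P.ν * inner ℝ (P.A.pow 1 w) (ψ.1 : H) =
        -(P.ω * inner ℝ v ψ) - inner ℝ (∫ s, η s ∂kernelMeasure P.μ₂) ψ := by
    intro w v η v'
    rw [ContinuousLinearMap.ext_iff]
    refine forall_congr' fun ψ => ?_
    rw [← P.A.integral_powNeg hμ₂, ← P.A.inner_pow _ v ψ, ← real_inner_smul_left,
      ← inner_add_left]
    rfl
  constructor
  · rintro ⟨u, w, v, ηbar, ζbar, ηbar', η, ζ, η', w', v', hU, hV, hb, he, e1, e2, e3, e4⟩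
    refine ⟨u, w, v, ηbar, ζbar, η, ζ, w', v', hU, ?_, hb, he, (h1 _ _ _ _).1 e1,
      (h2 _ _ _ _).1 e2⟩
    have h3 : ηbar' = constMem hμ₁ w - ζbar := by
      refine Lp.ext ?_
      filter_upwards [e3, Lp.coeFn_sub (constMem hμ₁ w) ζbar, constMem_ae hμ₁ w] with s a1 a2 a3
      rw [a1, a2, Pi.sub_apply, a3]
      abel
    have h4 : η' = constMem hμ₂ v - ζ := by
      refine Lp.ext ?_
      filter_upwards [e4, Lp.coeFn_sub (constMem hμ₂ v) ζ, constMem_ae hμ₂ v] with s a1 a2 a3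
      rw [a1, a2, Pi.sub_apply, a3]
      abel
    rw [hV, h3, h4]
  · rintro ⟨u, w, v, ηbar, ζbar, η, ζ, w', v', hU, hV, hb, he, e1, e2⟩
    refine ⟨u, w, v, ηbar, ζbar, _, η, ζ, _, w', v', hU, hV, hb, he, (h1 _ _ _ _).2 e1,
      (h2 _ _ _ _).2 e2, ?_, ?_⟩
    · filter_upwards [Lp.coeFn_sub (constMem hμ₁ w) ζbar, constMem_ae hμ₁ w] with s a2 a3
      rw [a2, Pi.sub_apply, a3]
      abel
    · filter_upwards [Lp.coeFn_sub (constMem hμ₂ v) ζ, constMem_ae hμ₂ v] with s a2 a3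
      rw [a2, Pi.sub_apply, a3]
      abel

/-- The graph of the linear part of the model, as a subspace. -/
def linearGraph (hμ₁ : IsMemoryKernel P.μ₁ δ₁) (hμ₂ : IsMemoryKernel P.μ₂ δ₂) :
    Submodule ℝ (P.Phase × P.Phase) where
  carrier := {q | P.IsLinearPart q.1 q.2}
  zero_mem' := by
    refine (P.isLinearPart_iff hμ₁ hμ₂ _ _).2 ⟨0, 0, 0, 0, 0, 0, 0, 0, 0, rfl, ?_, .zero hμ₁,
      .zero hμ₂, fun φ => ?_, fun ψ => ?_⟩
    · rw [constMem_zero, constMem_zero, sub_zero, sub_zero]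
      rfl
    · have h0 : ((0 : P.Fhalf).1 : H) = 0 := rfl
      rw [integral_zero_mem, h0]
      simp
    · rw [integral_zero_mem]
      simp
  add_mem' := by
    intro q q' h h'
    obtain ⟨u, w, v, a, b, c, d, w', v', hU, hV, hb, he, e1, e2⟩ :=
      (P.isLinearPart_iff hμ₁ hμ₂ _ _).1 h
    obtain ⟨u2, w2, v2, a2, b2, c2, d2, w2', v2', hU2, hV2, hb2, he2, e12, e22⟩ :=
      (P.isLinearPart_iff hμ₁ hμ₂ _ _).1 h'
    refine (P.isLinearPart_iff hμ₁ hμ₂ _ _).2 ⟨u + u2, w + w2, v + v2, a + a2, b + b2, c + c2,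
      d + d2, w' + w2', v' + v2', ?_, ?_, hb.add hμ₁ hb2, he.add hμ₂ he2, fun φ => ?_, fun ψ => ?_⟩
    · rw [Prod.fst_add, hU, hU2]
      rfl
    · rw [Prod.snd_add, hV, hV2, constMem_add, constMem_add, add_sub_add_comm, add_sub_add_comm]
      rfl
    · have h0 : ((v + v2).1 : H) = v.1 + v2.1 := rfl
      rw [integral_add_mem hμ₁, h0]
      simp only [inner_add_left, e1, e12]
      ring
    · have h1 := e2 ψ
      have h2 := e22 ψ
      rw [integral_add_mem hμ₂]
      simp only [map_add, inner_add_left]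
      linarith
  smul_mem' := by
    intro r q h
    obtain ⟨u, w, v, a, b, c, d, w', v', hU, hV, hb, he, e1, e2⟩ :=
      (P.isLinearPart_iff hμ₁ hμ₂ _ _).1 h
    refine (P.isLinearPart_iff hμ₁ hμ₂ _ _).2 ⟨r • u, r • w, r • v, r • a, r • b, r • c,
      r • d, r • w', r • v', ?_, ?_, hb.smul hμ₁ r, he.smul hμ₂ r, fun φ => ?_, fun ψ => ?_⟩
    · rw [Prod.smul_fst, hU]
      rfl
    · rw [Prod.smul_snd, hV, constMem_smul, constMem_smul, ← smul_sub, ← smul_sub]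
      rfl
    · have h0 : ((r • v).1 : H) = r • v.1 := rfl
      rw [integral_smul_mem, h0]
      simp only [real_inner_smul_left, e1]
      ring
    · have h1 := e2 ψ
      rw [integral_smul_mem]
      simp only [map_smul, real_inner_smul_left]
      linear_combination r * h1

theorem eq_zero_of_isLinearPart_zero (hμ₁ : IsMemoryKernel P.μ₁ δ₁)
    (hμ₂ : IsMemoryKernel P.μ₂ δ₂) {V : P.Phase} (h : P.IsLinearPart 0 V) : V = 0 := by
  obtain ⟨u, w, v, a, b, c, d, w', v', hU, hV, hb, he, e1, e2⟩ :=
    (P.isLinearPart_iff hμ₁ hμ₂ _ _).1 h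
  obtain ⟨hu, hw, hv, ha, hc⟩ := P.state_inj (u := 0) (w := 0) (v := 0) (a := 0) (b := 0) hU
  have hw0 : w = 0 := Subtype.ext hw.symm
  have hv0 : v = 0 := Subtype.ext hv.symm
  subst hu ha hc hw0 hv0
  have h0 : ((0 : P.Fhalf).1 : H) = 0 := rfl
  have hw' : w' = 0 := P.A.eq_zero_of_inner_eq_zero fun φ => by
    rw [e1 φ, integral_zero_mem, h0]
    simp
  have hv' : v' = 0 := P.A.eq_zero_of_inner_eq_zero fun ψ => by
    have := e2 ψ
    rw [integral_zero_mem] at this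
    simpa using this
  rw [hV, hw', hv', hb.eq_zero hμ₁, he.eq_zero hμ₂, constMem_zero, constMem_zero, sub_zero,
    sub_zero]
  rfl

/-- Testing the second equation with `w` and the third with `v`, the elastic terms `β(u, w)`, the
coupling `ν(v, Aw)` and the memory means cancel. There remains `-ω‖v‖² - (ζ̄, η̄) - (ζ, η)`. -/
theorem inner_rescale_nonpos (hμ₁ : IsMemoryKernel P.μ₁ δ₁) (hμ₂ : IsMemoryKernel P.μ₂ δ₂)
    (hβ : 0 < P.β) (hω : 0 ≤ P.ω) {U V : P.Phase} (h : P.IsLinearPart U V) :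
    inner ℝ (P.rescale hβ V) (P.rescale hβ U) ≤ 0 := by
  obtain ⟨u, w, v, a, b, c, d, w', v', rfl, rfl, hb, he, e1, e2⟩ :=
    (P.isLinearPart_iff hμ₁ hμ₂ _ _).1 h
  rw [rescale_state, rescale_state, inner_state, real_inner_smul_left, real_inner_smul_right,
    ← mul_assoc, Real.mul_self_sqrt hβ.le, inner_sub_left, inner_sub_left, inner_constMem,
    inner_constMem]
  have h1 := e1 w
  have h2 := e2 v
  have h3 := hb.inner_nonneg hμ₁
  have h4 := he.inner_nonneg hμ₂
  rw [real_inner_comm] at h1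
  rw [real_inner_self_eq_norm_sq] at h2
  have h5 : 0 ≤ P.ω * ‖v‖ ^ 2 := by positivity
  have h6 : inner ℝ (w' : H) (w.1 : H) = inner ℝ (w.1 : H) w' := real_inner_comm _ _
  have h7 : inner ℝ (P.A.pow 1 w) (v.1 : H) = inner ℝ (v.1 : H) (P.A.pow 1 w) :=
    real_inner_comm _ _
  have h8 := real_inner_comm u w
  have h9 := real_inner_comm w (∫ s, a s ∂kernelMeasure P.μ₁)
  have h10 := real_inner_comm v (∫ s, c s ∂kernelMeasure P.μ₂)
  rw [h7] at h2
  rw [h8, h6, h1, ← h9, ← h10]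
  nlinarith

/-- Eliminate `u = w + f₁` and split each memory variable into a part driven by the datum and the
part `(1 - e^{-s})w`, respectively `(1 - e^{-s})v`. The means `c₁ w`, `c₂ v` of the latter join the
elliptic terms, leaving a weak problem for `(w, v)` with coefficients `β + c₁` and `ω + c₂`. -/
theorem exists_isLinearPart_sub (hμ₁ : IsMemoryKernel P.μ₁ δ₁) (hμ₂ : IsMemoryKernel P.μ₂ δ₂)
    (hβ : 0 < P.β) (hω : 0 ≤ P.ω) (hdiss : 0 < P.ω ∨ ∃ s, 0 < s ∧ 0 < P.μ₂ s) (Z : P.Phase) :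
    ∃ U V, P.IsLinearPart U V ∧ U - V = Z := by
  obtain ⟨f₁, f₂, f₃, f₄, f₅, rfl⟩ : ∃ f₁ f₂ f₃ f₄ f₅, Z = P.state f₁ f₂ f₃ f₄ f₅ :=
    ⟨Z.fst, Z.snd.fst, Z.snd.snd.fst, Z.snd.snd.snd.fst, Z.snd.snd.snd.snd, rfl⟩
  obtain ⟨a, ha⟩ := hμ₁.exists_hasMemoryDeriv f₄
  obtain ⟨b, hb⟩ := hμ₂.exists_hasMemoryDeriv f₅
  obtain ⟨c₁, hc₁, -, hc₁'⟩ := exists_hasMemoryDeriv_const (F := P.F1) hμ₁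
  obtain ⟨c₂, hc₂, hc₂pos, hc₂'⟩ := exists_hasMemoryDeriv_const (F := P.Fhalf) hμ₂
  -- Coercivity in `v`: when `ω = 0` it is supplied by the memory kernel alone.
  have hγ : 0 < P.ω + c₂ := by
    rcases hdiss with h | h
    · positivity
    · have := hc₂pos h
      positivity
  let g₁ : P.F1 →L[ℝ] ℝ := (innerSL ℝ f₂).comp (P.A.incl 1) - innerSL ℝ (P.β • f₁)
    - innerSL ℝ (∫ s, a s ∂kernelMeasure P.μ₁)
  let g₂ : P.Fhalf →L[ℝ] ℝ := (innerSL ℝ f₃).comp (P.A.incl (1 / 2))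
    - innerSL ℝ (∫ s, b s ∂kernelMeasure P.μ₂)
  obtain ⟨w, v, h1, h2⟩ := exists_weak_solution (P.A.incl 1) (P.A.incl (1 / 2))
    (P.A.pow 1).toContinuousLinearMap (add_pos_of_pos_of_nonneg hβ hc₁) hγ P.ν g₁ g₂
  obtain ⟨r, hr, hri⟩ := hc₁' w
  obtain ⟨ρ, hρ, hρi⟩ := hc₂' v
  refine ⟨P.state (w + f₁) w.1 v.1 (a + r) (b + ρ), P.state w (w.1 - f₂) (v.1 - f₃)
    (constMem hμ₁ w - (f₄ - a + (constMem hμ₁ w - r)))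
    (constMem hμ₂ v - (f₅ - b + (constMem hμ₂ v - ρ))),
    (P.isLinearPart_iff hμ₁ hμ₂ _ _).2 ⟨w + f₁, w, v, a + r, f₄ - a + (constMem hμ₁ w - r), b + ρ,
      f₅ - b + (constMem hμ₂ v - ρ), w.1 - f₂, v.1 - f₃, rfl, rfl, ha.add hμ₁ hr, hb.add hμ₂ hρ,
      fun φ => ?_, fun ψ => ?_⟩, ?_⟩
  · have h3 : inner ℝ (w.1 : H) (φ.1 : H) + (P.β + c₁) * inner ℝ w φ
        - P.ν * inner ℝ (v.1 : H) (P.A.pow 1 φ) = inner ℝ f₂ (φ.1 : H) - inner ℝ (P.β • f₁) φ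
        - inner ℝ (∫ s, a s ∂kernelMeasure P.μ₁) φ := h1 φ
    rw [integral_add_mem hμ₁, hri, inner_sub_left]
    simp only [inner_add_left, real_inner_smul_left] at h3 ⊢
    linarith
  · have h3 : inner ℝ (v.1 : H) (ψ.1 : H) + (P.ω + c₂) * inner ℝ v ψ
        + P.ν * inner ℝ (P.A.pow 1 w) (ψ.1 : H) = inner ℝ f₃ (ψ.1 : H)
        - inner ℝ (∫ s, b s ∂kernelMeasure P.μ₂) ψ := h2 ψ
    rw [integral_add_mem hμ₂, hρi, inner_sub_left]
    simp only [inner_add_left, real_inner_smul_left] at h3 ⊢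
    linarith
  · have e : ∀ {G : Type _} [AddCommGroup G] (x y f z : G), x + y - (z - (f - x + (z - y))) = f := by
      intros
      abel
    rw [state_sub, e, e, sub_sub_cancel, sub_sub_cancel, add_sub_cancel_left]

theorem isMaxDissipative (hμ₁ : IsMemoryKernel P.μ₁ δ₁) (hμ₂ : IsMemoryKernel P.μ₂ δ₂)
    (hβ : 0 < P.β) (hω : 0 ≤ P.ω) (hdiss : 0 < P.ω ∨ ∃ s, 0 < s ∧ 0 < P.μ₂ s) :
    IsMaxDissipative ((P.linearGraph hμ₁ hμ₂).map
      ((P.rescale hβ).toLinearMap.prodMap (P.rescale hβ).toLinearMap)) := by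
  refine ⟨?_, fun z => ?_, fun y hy => ?_⟩
  · rintro _ ⟨⟨U, V⟩, h, rfl⟩
    exact P.inner_rescale_nonpos hμ₁ hμ₂ hβ hω h
  · obtain ⟨U, V, h, hUV⟩ :=
      P.exists_isLinearPart_sub hμ₁ hμ₂ hβ hω hdiss ((P.rescale hβ).symm z)
    refine ⟨_, ⟨(U, V), h, rfl⟩, ?_⟩
    change P.rescale hβ U - P.rescale hβ V = z
    rw [← map_sub, hUV, ContinuousLinearEquiv.apply_symm_apply]
  · obtain ⟨⟨U, V⟩, h, hUV⟩ := hy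
    have h1 : P.rescale hβ U = 0 := (Prod.mk.inj hUV).1
    have h2 : P.rescale hβ V = y := (Prod.mk.inj hUV).2
    have h3 : U = 0 := (P.rescale hβ).map_eq_zero_iff.1 h1
    subst h3
    have h4 : V = 0 := P.eq_zero_of_isLinearPart_zero hμ₁ hμ₂ h
    rw [← h2, h4, map_zero]

theorem exists_isLinearSemigroup (hμ₁ : IsMemoryKernel P.μ₁ δ₁) (hμ₂ : IsMemoryKernel P.μ₂ δ₂)
    (hβ : 0 < P.β) (hω : 0 ≤ P.ω) (hdiss : 0 < P.ω ∨ ∃ s, 0 < s ∧ 0 < P.μ₂ s) :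
    ∃ E, P.IsLinearSemigroup E :=
  exists_semigroup_of_conj (P.rescale hβ) (P.isMaxDissipative hμ₁ hμ₂ hβ hω hdiss)

end PlateData

end Plate

/-! ### Powers of `A` in coordinates and elliptic regularity -/

namespace Plate

namespace DiagOp

variable {H : Type*} [NormedAddCommGroup H] [InnerProductSpace ℝ H] (A : DiagOp H)

theorem repr_pow (s : ℝ≥0) (v : A.Space s) (k : ℕ) :
    A.e.repr (A.pow s v) k = A.ev k ^ (s : ℝ) * A.e.repr v.1 k := by
  have h : A.pow s v = A.powₗ s v := rfl
  rw [h, A.repr_powₗ]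

theorem lower_coe {s t : ℝ≥0} (h : s ≤ t) (v : A.Space t) : (A.lower h v).1 = v.1 :=
  @Subtype.coe_mk _ (· ∈ A.dom s) v.1 (A.dom_anti h v.2)

theorem incl_apply (s : ℝ≥0) (v : A.Space s) : A.incl s v = v.1 := rfl

theorem inner_eq_of_repr {x y x' y' : H}
    (h : ∀ k, A.e.repr x k * A.e.repr y k = A.e.repr x' k * A.e.repr y' k) :
    inner ℝ x y = inner ℝ x' y' := by
  rw [← A.e.tsum_inner_mul_inner, ← A.e.tsum_inner_mul_inner]
  refine tsum_congr fun k => ?_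
  rw [real_inner_comm, ← A.e.repr_apply_apply, ← A.e.repr_apply_apply, h k, real_inner_comm (A.e k),
    ← A.e.repr_apply_apply, ← A.e.repr_apply_apply]

/-- The eigenvector `e k` as an element of `F_s`. -/
noncomputable def basisVec (s : ℝ≥0) (k : ℕ) : A.Space s := ⟨A.e k, A.e_mem_dom s k⟩

theorem basisVec_coe (s : ℝ≥0) (k : ℕ) : (A.basisVec s k).1 = A.e k := rfl

theorem pow_basisVec (s : ℝ≥0) (k : ℕ) :
    A.pow s (A.basisVec s k) = A.ev k ^ (s : ℝ) • A.e k := by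
  apply A.e.repr.injective
  ext j
  rw [A.repr_pow, basisVec_coe, A.e.repr_apply_apply, A.e.repr_apply_apply, real_inner_smul_right]
  rcases eq_or_ne j k with rfl | h
  · rfl
  · rw [A.e.orthonormal.inner_eq_zero h, mul_zero, mul_zero]

/-- If `(A^s u, A^s φ) = (g, φ)` for all `φ ∈ F_s`, then `u ∈ D(A^{2s})` and `A^{2s} u = g`. -/
theorem exists_pow_add_eq {s t : ℝ≥0} (hst : s ≤ t) (ht : s + s = t) {u : A.Space s} {g : H}
    (h : ∀ φ : A.Space s, inner ℝ u φ = inner ℝ g (φ.1 : H)) :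
    ∃ z : A.Space t, A.lower hst z = u ∧ A.pow t z = g := by
  -- With `g = A^t z`, testing against `e k` compares `ev k ^ (2s)` times the `k`-th coordinates of
  -- `u` and `z`, so these coincide.
  obtain ⟨z, rfl⟩ := A.pow_surjective t g
  refine ⟨z, ?_, rfl⟩
  apply Subtype.ext
  apply A.e.repr.injective
  ext k
  have h1 := h (A.basisVec s k)
  rw [← A.inner_pow, pow_basisVec, basisVec_coe, real_inner_smul_right, real_inner_comm,
    ← A.e.repr_apply_apply] at h1
  have h2 : inner ℝ (A.pow t z) (A.e k) = A.e.repr (A.pow t z) k := by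
    rw [real_inner_comm, ← A.e.repr_apply_apply]
  have h3 := h1.trans h2
  rw [A.repr_pow, A.repr_pow, ← mul_assoc, ← Real.rpow_add (A.ev_pos k)] at h3
  have h4 : (s : ℝ) + (s : ℝ) = (t : ℝ) := by rw [← ht, NNReal.coe_add]
  rw [h4] at h3
  rw [lower_coe]
  exact (mul_left_cancel₀ (Real.rpow_pos_of_pos (A.ev_pos k) _).ne' h3).symm

theorem inner_pow_add {s t : ℝ≥0} (hst : s ≤ t) (ht : s + s = t) (z : A.Space t) (φ : A.Space s) :
    inner ℝ (A.pow t z) (φ.1 : H) = inner ℝ (A.lower hst z) φ := by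
  rw [← A.inner_pow]
  refine A.inner_eq_of_repr fun k => ?_
  have h : A.ev k ^ (t : ℝ) = A.ev k ^ (s : ℝ) * A.ev k ^ (s : ℝ) := by
    rw [← Real.rpow_add (A.ev_pos k), ← NNReal.coe_add, ht]
  rw [A.repr_pow, A.repr_pow, A.repr_pow, lower_coe, h]
  ring

/-- For `s = 1/2` this turns the argument of `M` into `(u, Au)`, visibly continuous and quadratic on
`F_1`. -/
theorem norm_pow_sq {s t : ℝ≥0} (hst : s ≤ t) (ht : s + s = t) (u : A.Space t) :
    ‖A.pow s (A.lower hst u)‖ ^ 2 = inner ℝ (A.incl t u) (A.pow t u) := by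
  rw [← real_inner_self_eq_norm_sq]
  refine A.inner_eq_of_repr fun k => ?_
  rw [A.repr_pow, A.repr_pow, lower_coe, incl_apply]
  have h : A.ev k ^ (t : ℝ) = A.ev k ^ (s : ℝ) * A.ev k ^ (s : ℝ) := by
    rw [← Real.rpow_add (A.ev_pos k), ← NNReal.coe_add, ht]
  rw [h]
  ring

end DiagOp

/-! ### Continuity and Lipschitz bounds for the nonlinearity -/

namespace PlateData

variable {H : Type*} [NormedAddCommGroup H] [InnerProductSpace ℝ H] (P : PlateData H)

theorem berger_eq (u : P.F1) :
    P.berger u = P.M (inner ℝ (P.A.incl 1 u) (P.A.pow 1 u)) • P.A.pow 1 u := by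
  rw [berger, P.A.norm_pow_sq (half_le_self zero_le_one) (add_halves 1)]

theorem inner_incl_pow_nonneg (u : P.F1) : 0 ≤ inner ℝ (P.A.incl 1 u) (P.A.pow 1 u) := by
  rw [← P.A.norm_pow_sq (half_le_self zero_le_one) (add_halves 1)]
  positivity

theorem continuous_berger (hM : ContinuousOn P.M (Ici 0)) : Continuous P.berger := by
  have h1 : Continuous fun u : P.F1 => inner ℝ (P.A.incl 1 u) (P.A.pow 1 u) :=
    (P.A.incl 1).continuous.inner (P.A.pow 1).continuous
  have h2 : Continuous fun u : P.F1 => P.M (inner ℝ (P.A.incl 1 u) (P.A.pow 1 u)) :=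
    hM.comp_continuous h1 fun u => P.inner_incl_pow_nonneg u
  rw [funext P.berger_eq]
  exact h2.smul (P.A.pow 1).continuous

/-- The Gronwall argument compares a solution with one fixed state, so a Lipschitz bound centred at
`u₀` is enough. The arguments of `M` stay in a compact interval, on which `M` is Lipschitz. -/
theorem exists_norm_berger_sub_le (hM : LocallyLipschitzOn (Ici 0) P.M) (u₀ : P.F1) (R : ℝ) :
    ∃ C, 0 ≤ C ∧ ∀ u, ‖u‖ ≤ R → ‖P.berger u - P.berger u₀‖ ≤ C * ‖u - u₀‖ := by
  obtain ⟨c, hc0, hi⟩ : ∃ c, 0 ≤ c ∧ ∀ u, ‖P.A.incl 1 u‖ ≤ c * ‖u‖ :=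
    ⟨_, norm_nonneg (P.A.incl 1), (P.A.incl 1).le_opNorm⟩
  have hp : ∀ u, ‖P.A.pow 1 u‖ = ‖u‖ := (P.A.pow 1).norm_map
  set q : P.F1 → ℝ := fun u => inner ℝ (P.A.incl 1 u) (P.A.pow 1 u) with hq
  -- The maximum is there because `u₀` itself is not assumed to lie in the ball of radius `R`.
  set ρ := max (c * R * R) (q u₀) with hρ
  have hle : ∀ u, ‖u‖ ≤ R → q u ∈ Icc 0 ρ := fun u hu => by
    refine ⟨P.inner_incl_pow_nonneg u, le_trans ?_ (le_max_left _ _)⟩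
    refine (real_inner_le_norm _ _).trans ?_
    rw [hp]
    exact mul_le_mul ((hi u).trans (mul_le_mul_of_nonneg_left hu hc0)) hu (norm_nonneg _)
      (mul_nonneg hc0 ((norm_nonneg _).trans hu))
  have h₀ : q u₀ ∈ Icc 0 ρ := ⟨P.inner_incl_pow_nonneg u₀, le_max_right _ _⟩
  obtain ⟨K, hK⟩ := (hM.mono ((Icc_subset_Ici_self : Icc 0 ρ ⊆ Ici 0))).exists_lipschitzOnWith_of_compact
    isCompact_Icc
  have hR : 0 ≤ |R| := abs_nonneg R
  refine ⟨|P.M (q u₀)| + K * (c * |R| + c * ‖u₀‖) * |R|, by positivity, fun u hu => ?_⟩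
  have h1 : q u - q u₀ = inner ℝ (P.A.incl 1 (u - u₀)) (P.A.pow 1 u)
      + inner ℝ (P.A.incl 1 u₀) (P.A.pow 1 (u - u₀)) := by
    simp only [hq, map_sub, inner_sub_left, inner_sub_right]
    ring
  have hu' : ‖u‖ ≤ |R| := hu.trans (le_abs_self R)
  have h2 : |q u - q u₀| ≤ (c * |R| + c * ‖u₀‖) * ‖u - u₀‖ := by
    rw [h1]
    refine (abs_add_le _ _).trans ?_
    have h3 := abs_real_inner_le_norm (P.A.incl 1 (u - u₀)) (P.A.pow 1 u)
    have h4 := abs_real_inner_le_norm (P.A.incl 1 u₀) (P.A.pow 1 (u - u₀))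
    rw [hp] at h3 h4
    have h5 : ‖P.A.incl 1 (u - u₀)‖ * ‖u‖ ≤ c * ‖u - u₀‖ * |R| :=
      mul_le_mul (hi _) hu' (norm_nonneg _) (by positivity)
    have h6 := mul_le_mul_of_nonneg_right (hi u₀) (norm_nonneg (u - u₀))
    linarith
  have h3 : |P.M (q u) - P.M (q u₀)| ≤ K * |q u - q u₀| := hK.dist_le_mul _ (hle u hu) _ h₀
  have h4 : P.berger u - P.berger u₀ = P.M (q u₀) • P.A.pow 1 (u - u₀)
      + (P.M (q u) - P.M (q u₀)) • P.A.pow 1 u := by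
    rw [P.berger_eq, P.berger_eq, map_sub]
    module
  rw [h4]
  refine (norm_add_le _ _).trans ?_
  rw [norm_smul, norm_smul, hp, hp, Real.norm_eq_abs, Real.norm_eq_abs]
  have h5 : |P.M (q u) - P.M (q u₀)| * ‖u‖
      ≤ K * ((c * |R| + c * ‖u₀‖) * ‖u - u₀‖) * |R| :=
    mul_le_mul (h3.trans (mul_le_mul_of_nonneg_left h2 K.2)) hu' (norm_nonneg _) (by positivity)
  linarith

theorem norm_state_single (x : H) : ‖P.state 0 x 0 0 0‖ = ‖x‖ := by
  have h : ‖P.state 0 x 0 0 0‖ ^ 2 = ‖x‖ ^ 2 := by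
    rw [← real_inner_self_eq_norm_sq, inner_state]
    simp
  exact (sq_eq_sq₀ (norm_nonneg _) (norm_nonneg _)).1 h

theorem norm_fst_le (U : P.Phase) : ‖U.fst‖ ≤ ‖U‖ := by
  have h := WithLp.prod_norm_sq_eq_of_L2 U
  exact le_of_sq_le_sq (by nlinarith [sq_nonneg ‖U.snd‖]) (norm_nonneg _)

theorem nonlin_sub (U V : P.Phase) :
    P.nonlin U - P.nonlin V = P.state 0 (P.berger V.fst - P.berger U.fst) 0 0 0 := by
  rw [nonlin, nonlin, state_sub]
  simp only [sub_self]
  congr 1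
  abel

theorem norm_nonlin_sub (U V : P.Phase) :
    ‖P.nonlin U - P.nonlin V‖ = ‖P.berger U.fst - P.berger V.fst‖ := by
  rw [nonlin_sub, norm_state_single, norm_sub_rev]

theorem continuous_nonlin (hM : ContinuousOn P.M (Ici 0)) : Continuous P.nonlin := by
  have h1 : Continuous fun U : P.Phase => P.berger U.fst :=
    (P.continuous_berger hM).comp (WithLp.fstL 2 ℝ P.F1 _).continuous
  refine continuous_iff_continuousAt.2 fun V => ?_
  refine tendsto_iff_norm_sub_tendsto_zero.2 ?_
  simp only [norm_nonlin_sub]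
  exact tendsto_iff_norm_sub_tendsto_zero.1 (h1.tendsto V)

theorem exists_norm_nonlin_sub_le (hM : LocallyLipschitzOn (Ici 0) P.M) (U₀ : P.Phase) (R : ℝ) :
    ∃ C, 0 ≤ C ∧ ∀ U, ‖U‖ ≤ R → ‖P.nonlin U - P.nonlin U₀‖ ≤ C * ‖U - U₀‖ := by
  obtain ⟨C, hC0, hC⟩ := P.exists_norm_berger_sub_le hM U₀.fst R
  refine ⟨C, hC0, fun U hU => ?_⟩
  rw [norm_nonlin_sub]
  exact (hC _ ((P.norm_fst_le U).trans hU)).trans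
    (mul_le_mul_of_nonneg_left (P.norm_fst_le (U - U₀)) hC0)

theorem neg_nonlin (U : P.Phase) : -P.nonlin U = P.state 0 (P.berger U.fst - P.p) 0 0 0 := by
  have h := P.state_sub 0 0 0 (-P.berger U.fst + P.p) 0 0 0 0 0 0
  have h0 : P.state 0 0 0 0 0 = 0 := rfl
  rw [h0, zero_sub] at h
  rw [nonlin, h]
  simp only [sub_self]
  congr 1
  abel

/-! ### The stationary equation -/

variable [CompleteSpace H] {δ₁ δ₂ : ℝ}

/-- Here `η(s) = s v`, so the memory term is `∫ s‖v‖² μ₂(s) ds ≥ 0`. Both terms of the balance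
vanish, and one of them has a positive coefficient. -/
theorem eq_zero_of_memory_balance (hμ₂ : IsMemoryKernel P.μ₂ δ₂) (hω : 0 ≤ P.ω)
    (hdiss : 0 < P.ω ∨ ∃ s, 0 < s ∧ 0 < P.μ₂ s) {v : P.Fhalf} {η : MemorySpace P.μ₂ P.Fhalf}
    (h : HasMemoryDeriv η (constMem hμ₂ v))
    (hv : P.ω * ‖v‖ ^ 2 + inner ℝ (∫ s, η s ∂kernelMeasure P.μ₂) v = 0) : v = 0 := by
  have h1 := h.inner_nonneg hμ₂
  rw [inner_constMem, real_inner_comm] at h1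
  have h2 : 0 ≤ P.ω * ‖v‖ ^ 2 := by positivity
  by_contra hne
  have hn : 0 < ‖v‖ := norm_pos_iff.2 hne
  rcases hdiss with hω' | ⟨t, ht, hkt⟩
  · have : 0 < P.ω * ‖v‖ ^ 2 := by positivity
    linarith
  · have h3 : ∫ s, inner ℝ v (η s) ∂kernelMeasure P.μ₂ = 0 := by
      rw [integral_inner (hμ₂.integrable η), real_inner_comm]
      linarith
    have h4 : ∀ᵐ s ∂kernelMeasure P.μ₂, inner ℝ v (η s) = s * ‖v‖ ^ 2 := by
      filter_upwards [h.ae_eq_smul hμ₂] with s hs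
      rw [hs, real_inner_smul_right, real_inner_self_eq_norm_sq]
    have h5 : 0 ≤ᵐ[kernelMeasure P.μ₂] fun s => inner ℝ v (η s) := by
      filter_upwards [h4, hμ₂.ae_pos] with s hs1 hs2
      rw [hs1]
      exact mul_nonneg hs2.1.le (sq_nonneg _)
    have h6 := (integral_eq_zero_iff_of_nonneg_ae h5 ((hμ₂.integrable η).const_inner v)).1 h3
    -- If `v ≠ 0`, then `s‖v‖² = 0` almost everywhere leaves only a zero kernel measure, although
    -- that measure charges `(0, t]`.
    have h7 : ∀ᵐ s ∂kernelMeasure P.μ₂, False := by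
      filter_upwards [h4, h6, hμ₂.ae_pos] with s hs1 hs2 hs3
      rw [hs2, Pi.zero_apply] at hs1
      have := mul_pos hs3.1 (pow_pos hn 2)
      linarith
    have h8 := hμ₂.ae_Ioc h7 hkt
    rw [ae_iff] at h8
    simp at h8
    linarith

/-- The solutions of the stationary equation `L U + f(U) = 0`. -/
theorem isLinearPart_neg_nonlin_iff (hμ₁ : IsMemoryKernel P.μ₁ δ₁) (hμ₂ : IsMemoryKernel P.μ₂ δ₂)
    (hβ : 0 < P.β) (hω : 0 ≤ P.ω) (hdiss : 0 < P.ω ∨ ∃ s, 0 < s ∧ 0 < P.μ₂ s) (U : P.Phase) :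
    P.IsLinearPart U (-P.nonlin U) ↔ ∃ u : P.A.Space 2,
      U = P.state (P.A.lower one_le_two u) 0 0 0 0 ∧
      P.β • P.A.pow 2 u + P.berger (P.A.lower one_le_two u) = P.p := by
  rw [P.isLinearPart_iff hμ₁ hμ₂, neg_nonlin]
  constructor
  · rintro ⟨u, w, v, a, b, c, d, w', v', hU, hV, hb, hd, e1, e2⟩
    -- Comparing components gives `w = 0`, `v' = 0`, `η̄_s = w = 0` and `η_s = v`; the second
    -- component keeps the equation for `u`.
    obtain ⟨hw, hw', hv', hb', hd'⟩ := P.state_inj hV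
    subst hw hv'
    rw [constMem_zero, zero_sub, eq_comm, neg_eq_zero] at hb'
    rw [eq_comm, sub_eq_zero, eq_comm] at hd'
    subst hb' hd'
    have ha : a = 0 := by
      refine Lp.ext ?_
      rw [← constMem_zero hμ₁] at hb
      filter_upwards [hb.ae_eq_smul hμ₁, Lp.coeFn_zero P.F1 2 (kernelMeasure P.μ₁)] with s h1 h2
      rw [h1, h2, smul_zero, Pi.zero_apply]
    subst ha
    have hv : v = 0 := by
      refine P.eq_zero_of_memory_balance hμ₂ hω hdiss hd ?_
      have h1 := e2 v
      rw [real_inner_self_eq_norm_sq, map_zero, inner_zero_left] at h1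
      linarith
    subst hv
    rw [constMem_zero] at hd
    have hc : c = 0 := by
      refine Lp.ext ?_
      rw [← constMem_zero hμ₂] at hd
      filter_upwards [hd.ae_eq_smul hμ₂, Lp.coeFn_zero P.Fhalf 2 (kernelMeasure P.μ₂)] with s h1 h2
      rw [h1, h2, smul_zero, Pi.zero_apply]
    subst hc
    have hu : U.fst = u := congrArg (fun V : P.Phase => V.fst) hU
    rw [hu] at hw'
    -- With the other unknowns gone, this is the weak form of `A²u = β⁻¹(p - M(‖A^{1/2}u‖²)Au)` with
    -- right side in `H`, as elliptic regularity requires.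
    have h1 : ∀ φ : P.F1, inner ℝ u φ = inner ℝ (P.β⁻¹ • (P.p - P.berger u)) (φ.1 : H) := fun φ => by
      have h2 := e1 φ
      have h0 : ((0 : P.Fhalf).1 : H) = 0 := rfl
      rw [integral_zero_mem, h0, inner_zero_left, inner_zero_left, ← hw', ← neg_sub,
        inner_neg_left] at h2
      rw [real_inner_smul_left, eq_inv_mul_iff_mul_eq₀ hβ.ne']
      linarith
    obtain ⟨z, rfl, hz⟩ := P.A.exists_pow_add_eq one_le_two one_add_one_eq_two h1
    refine ⟨z, hU, ?_⟩
    rw [hz, smul_inv_smul₀ hβ.ne', sub_add_cancel]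
  · rintro ⟨u, rfl, hu⟩
    refine ⟨P.A.lower one_le_two u, 0, 0, 0, 0, 0, 0, P.berger (P.A.lower one_le_two u) - P.p, 0,
      rfl, ?_, .zero hμ₁, .zero hμ₂, fun φ => ?_, fun ψ => ?_⟩
    · rw [constMem_zero, constMem_zero, sub_zero, sub_zero]
      rfl
    · have h0 : ((0 : P.Fhalf).1 : H) = 0 := rfl
      rw [integral_zero_mem, h0, inner_zero_left, inner_zero_left, ← P.A.inner_pow_add one_le_two one_add_one_eq_two,
        ← hu, sub_add_cancel_right, inner_neg_left, real_inner_smul_left]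
      ring
    · rw [integral_zero_mem]
      simp

end PlateData
end Plate

/-! ### Uniqueness from a stationary state and identification of the stationary points -/

namespace Plate

/-- A continuous nonnegative function bounded by a multiple of its primitive vanishes. -/
theorem eq_zero_of_le_integral {g : ℝ → ℝ} (hg : Continuous g) (hg0 : ∀ t, 0 ≤ g t)
    {K T : ℝ} (h : ∀ t ∈ Icc 0 T, g t ≤ K * ∫ τ in (0 : ℝ)..t, g τ) : ∀ t ∈ Icc 0 T, g t = 0 := by
  have hd : ∀ t, HasDerivAt (fun t => ∫ τ in (0 : ℝ)..t, g τ) (g t) t := fun t =>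
    (hg.integral_hasStrictDerivAt 0 t).hasDerivAt
  intro t ht
  -- Gronwall is applied to the primitive `G` of `g`, for which `G' ≤ K G` and `G(0) = 0`.
  have h1 := norm_le_gronwallBound_of_norm_deriv_right_le (δ := 0) (K := K) (ε := 0) (a := 0) (b := T)
    (f := fun t => ∫ τ in (0 : ℝ)..t, g τ) (f' := g)
    (fun s _ => (hd s).continuousAt.continuousWithinAt) (fun s _ => (hd s).hasDerivWithinAt)
    (by simp) (fun s hs => ?_) t ht
  · rw [gronwallBound_ε0_δ0, norm_le_zero_iff] at h1
    have h2 := h t ht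
    rw [h1, mul_zero] at h2
    exact le_antisymm h2 (hg0 t)
  · have h3 : 0 ≤ ∫ τ in (0 : ℝ)..s, g τ :=
      intervalIntegral.integral_nonneg hs.1 fun τ _ => hg0 τ
    rw [Real.norm_of_nonneg (hg0 s), Real.norm_of_nonneg h3, add_zero]
    exact h s (Ico_subset_Icc_self hs)

namespace PlateData

variable {H : Type*} [NormedAddCommGroup H] [InnerProductSpace ℝ H] [CompleteSpace H]
  (P : PlateData H)

/-- A mild solution starting from a solution of the stationary equation is constant. -/
theorem eqOn_of_isMildSolution (hM : LocallyLipschitzOn (Ici 0) P.M) {U₀ : P.Phase}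
    (h₀ : P.IsLinearPart U₀ (-P.nonlin U₀)) {T : ℝ} (hT : 0 < T) {V : ℝ → P.Phase}
    (hV : P.IsMildSolution T U₀ V) : EqOn V (fun _ => U₀) (Icc 0 T) := by
  obtain ⟨hVc, E, ⟨hE, hgen⟩, hVE⟩ := hV
  -- The mild identity for `U₀` is taken with the semigroup attached to `V`. Any semigroup generated
  -- by `L` will do, so no uniqueness of semigroups is involved.
  have hconst := (hE.isGenerated_neg_iff U₀ (P.nonlin U₀) hT).1 ((hgen _ _).2 h₀)
  -- Extending `V` by its endpoint values gives a function continuous on all of `ℝ`, as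
  -- `eq_zero_of_le_integral` demands.
  set W : ℝ → P.Phase := IccExtend hT.le ((Icc 0 T).domRestrict V) with hW
  have hWc : Continuous W := (continuousOn_iff_continuous_domRestrict.1 hVc).Icc_extend'
  have hWV : ∀ t ∈ Icc 0 T, W t = V t := fun t ht => IccExtend_of_mem hT.le _ ht
  obtain ⟨R, hR⟩ := isCompact_Icc.exists_bound_of_continuousOn hVc
  obtain ⟨K, hK0, hK⟩ := P.exists_norm_nonlin_sub_le hM U₀ R
  obtain ⟨C, hC0, hC⟩ := hE.exists_bound T
  have hf := P.continuous_nonlin hM.continuousOn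
  have hbound : ∀ t ∈ Icc 0 T, ‖W t - U₀‖ ≤ C * K * ∫ τ in (0 : ℝ)..t, ‖W τ - U₀‖ := by
    intro t ht
    have hint : ∀ h : ℝ → P.Phase, Continuous h →
        IntervalIntegrable (fun τ => E (t - τ) (h τ)) volume 0 t := fun h hh => by
      refine ContinuousOn.intervalIntegrable ?_
      rw [uIcc_of_le ht.1]
      exact hE.continuousOn_apply (by fun_prop) (fun τ hτ => sub_nonneg.2 hτ.2) hh.continuousOn
    have h1 : V t = E t U₀ + ∫ τ in (0 : ℝ)..t, E (t - τ) (P.nonlin (W τ)) := by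
      rw [hVE t ht]
      congr 1
      refine intervalIntegral.integral_congr fun τ hτ => ?_
      rw [uIcc_of_le ht.1] at hτ
      simp only [hWV τ ⟨hτ.1, hτ.2.trans ht.2⟩]
    have h2 : W t - U₀ = ∫ τ in (0 : ℝ)..t, E (t - τ) (P.nonlin (W τ) - P.nonlin U₀) := by
      simp only [map_sub]
      rw [intervalIntegral.integral_sub (hint (fun τ => P.nonlin (W τ)) (hf.comp hWc))
        (hint (fun _ => P.nonlin U₀) continuous_const), hWV t ht, h1]
      have h4 := hconst t ht
      rw [← sub_eq_iff_eq_add'] at h4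
      rw [← h4]
      abel
    rw [h2, ← intervalIntegral.integral_const_mul]
    refine intervalIntegral.norm_integral_le_of_norm_le ht.1 (Eventually.of_forall fun τ hτ => ?_)
      (Continuous.intervalIntegrable (by fun_prop) _ _)
    have hτT : τ ∈ Icc 0 T := ⟨hτ.1.le, hτ.2.trans ht.2⟩
    refine ((E (t - τ)).le_of_opNorm_le (hC _ ⟨sub_nonneg.2 hτ.2, by linarith [hτ.1, ht.2]⟩) _).trans ?_
    rw [mul_assoc]
    refine mul_le_mul_of_nonneg_left (hK _ ?_) hC0
    rw [hWV τ hτT]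
    exact hR τ hτT
  intro t ht
  have h3 := eq_zero_of_le_integral (g := fun t => ‖W t - U₀‖) (by fun_prop)
    (fun t => norm_nonneg _) hbound t ht
  rw [norm_eq_zero, sub_eq_zero, hWV t ht] at h3
  exact h3

theorem isTrajectory_const (hM : LocallyLipschitzOn (Ici 0) P.M) {E : ℝ → P.Phase →L[ℝ] P.Phase}
    (hE : P.IsLinearSemigroup E) {U₀ : P.Phase} (h₀ : P.IsLinearPart U₀ (-P.nonlin U₀)) :
    P.IsTrajectory U₀ fun _ => U₀ := fun _ hT =>
  ⟨⟨continuousOn_const, E, hE,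
    (hE.1.isGenerated_neg_iff U₀ (P.nonlin U₀) hT).1 ((hE.2 _ _).2 h₀)⟩,
    fun _ hV => P.eqOn_of_isMildSolution hM h₀ hT hV⟩

/-- The stationary points are the solutions of `L U + f(U) = 0`. -/
theorem mem_stationaryPoints_iff (hM : LocallyLipschitzOn (Ici 0) P.M)
    (hE : ∃ E, P.IsLinearSemigroup E) (U₀ : P.Phase) :
    U₀ ∈ P.stationaryPoints ↔ P.IsLinearPart U₀ (-P.nonlin U₀) := by
  constructor
  · intro h
    have h1 : ∀ t, 0 ≤ t → U₀ ∈ P.semiflow t U₀ := fun t ht => Part.eq_some_iff.1 (h t ht)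
    obtain ⟨hdom, -⟩ := h1 0 le_rfl
    -- The domain of the partial semiflow does not depend on `t`, so a single chosen trajectory
    -- serves all times and is constantly `U₀`.
    have hU : ∀ t, 0 ≤ t → hdom.choose t = U₀ := fun t ht => by
      obtain ⟨_, h2⟩ := h1 t ht
      exact h2
    obtain ⟨⟨-, E, ⟨hE, hgen⟩, hmild⟩, -⟩ := hdom.choose_spec 1 one_pos
    refine (hgen _ _).1 ((hE.isGenerated_neg_iff U₀ (P.nonlin U₀) one_pos).2 fun t ht => ?_)
    have h2 := hmild t ht
    rw [hU t ht.1] at h2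
    refine h2.trans ?_
    congr 1
    refine intervalIntegral.integral_congr fun τ hτ => ?_
    rw [uIcc_of_le ht.1] at hτ
    simp only [hU τ hτ.1]
  · intro h t ht
    obtain ⟨E, hE⟩ := hE
    have htraj := P.isTrajectory_const hM hE h
    have hdom : ∃ U, P.IsTrajectory U₀ U := ⟨_, htraj⟩
    refine Part.eq_some_iff.2 ⟨hdom, ?_⟩
    -- The chosen trajectory need not be the constant one, but uniqueness identifies them. The
    -- horizon `t + 1` is used because it must be positive also for `t = 0`.
    exact (htraj (t + 1) (by linarith)).2 _ (hdom.choose_spec (t + 1) (by linarith)).1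
      ⟨ht, by linarith⟩

end PlateData
end Plate

theorem proposition2p5 {H : Type*} [NormedAddCommGroup H] [InnerProductSpace ℝ H] [CompleteSpace H]
    (P : Plate.PlateData H)
    (hβ : 0 < P.β) (hν : 0 < P.ν) (hω : P.ω ∈ Set.Ico (0 : ℝ) 1)
    (δ₁ δ₂ : ℝ) (hμ₁ : Plate.IsMemoryKernel P.μ₁ δ₁) (hμ₂ : Plate.IsMemoryKernel P.μ₂ δ₂)
    (hdiss : 0 < P.ω ∨ ∃ s, 0 < s ∧ 0 < P.μ₂ s)
    (hM : ContDiffOn ℝ 2 P.M (Set.Ioi 0)) (hM0 : LocallyLipschitzOn (Set.Ici 0) P.M)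
    (a b : ℝ) (ha : a ∈ Set.Ioo 0 (P.A.ev 0))
    (hMint : ∀ z, 0 ≤ z → -a * z - b ≤ ∫ ξ in (0 : ℝ)..z, P.M ξ) :
    P.stationaryPoints =
      {U | ∃ u : P.A.Space 2,
        U = P.state (P.A.lower one_le_two u) 0 0 0 0 ∧
        P.β • P.A.pow 2 u + P.berger (P.A.lower one_le_two u) = P.p} := by
  ext U
  rw [P.mem_stationaryPoints_iff hM0
    (P.exists_isLinearSemigroup hμ₁ hμ₂ hβ hω.1 hdiss),
    P.isLinearPart_neg_nonlin_iff hμ₁ hμ₂ hβ hω.1 hdiss]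
  rfl
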